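/- Let $\Bbbk$ be an algebraically closed field of characteristic zero and let $\mathcal C$ be a finite tensor category over $\Bbbk$: a finite $\Bbbk$-linear abelian category with a rigid monoidal structure, $\Bbbk$-bilinear on morphisms, whose unit object $\mathbf 1$ is simple. Write $X^*$ for the dual of $X$ with $\mathrm{ev}_X: X^*\otimes X\to\mathbf 1$, $\mathrm{coev}_X:\mathbf 1\to X\otimes X^*$, and ${}^*X$ for the other dual, with $X\otimes {}^*X\to\mathbf 1$. Let $\mathcal D\subseteq\mathcal C$ be a tensor subcategory, i.e. a full subcategory containing $\mathbf 1$ and closed under subobjects, quotients, finite direct sums, tensor products and both duals. The adjoint algebra $\mathcal A_{\mathcal C}$ is the end $\int_{X\in\mathcal C}X\otimes X^*$, with universal dinatural transformation $\pi_X:\mathcal A_{\mathcal C}\to X\otimes X^*$. It is an algebra in the Drinfeld center $Z(\mathcal C)$: its half-braiding $\sigma_X:\mathcal A_{\mathcal C}\otimes X\to X\otimes\mathcal A_{\mathcal C}$, product $m$ and unit $u$ are determined, for all objects $X,M$ of $\mathcal C$, by $$(\mathrm{id}_X\otimes\pi_M)\,\sigma_X=(\mathrm{id}_{X\otimes M\otimes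 M^*}\otimes \mathrm{ev}_X)(\pi_{X\otimes M}\otimes\mathrm{id}_X),\quad \pi_M\, m=(\mathrm{id}_M\otimes\mathrm{ev}_M\otimes\mathrm{id}_{M^*})(\pi_M\otimes\pi_M),\quad \pi_M\, u=\mathrm{coev}_M,$$ where associativities and the isomorphism $(X\otimes M)^*\simeq M^*\otimes X^*$ are suppressed. The algebra $\mathcal A_{\mathcal D}$ in $Z(\mathcal D)$, with dinatural transformation $\lambda_Y:\mathcal A_{\mathcal D}\to Y\otimes Y^*$ ($Y\in\mathcal D$), is the adjoint algebra of $\mathcal D$. The algebra $\mathcal A(\mathcal D)=\mathcal A_{\mathcal D^{\rm rev},\mathcal C}$ in $Z(\mathcal C)$ is the relative end of the bifunctor $S(M,N)=N\otimes M^*$ on $\mathcal C$ with respect to the action $D\triangleright M=M\otimes D$ of the category $\mathcal D^{\rm rev}$ ($\mathcal D$ with the reversed tensor product) and the prebalancing $$\beta^D_{M,N}:(N\otimes D)\otimes M^*\to N\otimes(M\otimes{}^*D)^*$$ given by the associativity and the canonical isomorphism $(M\otimes{}^*D)^*\simeq D\otimes M^*$. That is, it carries a dinatural transformation $\alpha_M:\mathcal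 A(\mathcal D)\to M\otimes M^*$ which is universal among the dinatural transformations satisfying, for all $D\in\mathcal D$ and $M\in\mathcal C$, $$S(\mathrm{id}_M\otimes e_D,\mathrm{id}_M)\,\alpha_M=S(a,\mathrm{id}_M)\,\beta^D_{M\otimes D,M}\,\alpha_{M\otimes D},$$ where $e_D:D\otimes{}^*D\to\mathbf 1$ is the evaluation, $M\otimes\mathbf 1$ is identified with $M$, and $a:M\otimes(D\otimes{}^*D)\to(M\otimes D)\otimes{}^*D$ is the associativity. Its half-braiding, product and unit are determined by the same three formulas with $\alpha$ in place of $\pi$. Then the algebras $\mathcal A(\mathcal D)$, $\mathcal A_{\mathcal C}$ and $\mathcal A_{\mathcal D}$ exist, and there are algebra morphisms $$\mathcal A(\mathcal D)\xrightarrow{\ \iota\ }\mathcal A_{\mathcal C}\xrightarrow{\ q\ }\mathcal A_{\mathcal D}$$ ($\iota$ in $Z(\mathcal C)$, and $q$ between the underlying algebras in $\mathcal C$) such that $\pi_X\circ\iota=\alpha_X$ for all $X\in\mathcal C$, $\lambda_Y\circ q=\pi_Y$ for all $Y\in\mathcal D$, and $$q\circ\iota=u\circ\alpha_{\mathbf 1},$$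 where $u:\mathbf 1\to\mathcal A_{\mathcal D}$ is the unit of $\mathcal A_{\mathcal D}$ and $\mathbf 1\otimes\mathbf 1^*$ is identified with $\mathbf 1$. In particular $q\circ\iota$ factors through the unit of $\mathcal A_{\mathcal D}$. -/

import Mathlib

open CategoryTheory MonoidalCategory Limits Opposite MonoidalOpposite
open scoped MonObj CategoryTheory.MonoidalCategory.MonoidalLeftAction

universe w v u v' u'

/-- A finite tensor category over a field `k`: a `k`-linear abelian category with finite
dimensional morphism spaces, objects of finite length, enough projective objects and finitely many
isomorphism classes of simple objects, together with a rigid monoidal structure whose tensor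
product is `k`-bilinear on morphisms and whose unit object is simple. -/
class IsFiniteTensorCategory (k : Type w) [Field k] (C : Type u) [Category.{v} C] [Abelian C]
    [Linear k C] [MonoidalCategory C] [MonoidalPreadditive C] [MonoidalLinear k C]
    [RigidCategory C] : Prop where
  finite_hom : ∀ X Y : C, Module.Finite k (X ⟶ Y)
  isNoetherianObject : ∀ X : C, IsNoetherianObject X
  isArtinianObject : ∀ X : C, IsArtinianObject X
  enoughProjectives : EnoughProjectives C
  finite_simple : ∃ (n : ℕ) (S : Fin n → C), ∀ X : C, Simple X → ∃ i, Nonempty (X ≅ S i)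
  simple_unit : Simple (𝟙_ C)

/-- A tensor subcategory of a finite tensor category: a full subcategory which contains the unit
object and is closed under subobjects, quotients, finite direct sums, tensor products and both
duals. -/
class IsTensorSubcategory {C : Type u} [Category.{v} C] [MonoidalCategory C] [RigidCategory C]
    (D : ObjectProperty C) : Prop extends D.IsMonoidal, D.IsClosedUnderSubobjects,
    D.IsClosedUnderQuotients, D.IsClosedUnderFiniteProducts where
  prop_rightDual : ∀ X : C, D X → D (Xᘁ)
  prop_leftDual : ∀ X : C, D X → D (ᘁX : C)

namespace AdjointAlgebras

section Rigid

variable {C : Type u} [Category.{v} C] [MonoidalCategory C] [RigidCategory C]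

/-- An exact pairing in `C` between objects of a full monoidal subcategory is an exact pairing
in the subcategory. -/
@[reducible]
def exactPairingFull (D : ObjectProperty C) [D.IsMonoidal] (X Y : D.FullSubcategory)
    [ExactPairing X.obj Y.obj] : ExactPairing X Y where
  coevaluation' := ObjectProperty.homMk (η_ X.obj Y.obj)
  evaluation' := ObjectProperty.homMk (ε_ X.obj Y.obj)
  coevaluation_evaluation' := by
    ext; exact ExactPairing.coevaluation_evaluation X.obj Y.obj
  evaluation_coevaluation' := by
    ext; exact ExactPairing.evaluation_coevaluation X.obj Y.obj

/-- The dual objects in a tensor subcategory are the dual objects in the ambient category. -/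
instance rigidFull (D : ObjectProperty C) [IsTensorSubcategory D] :
    RigidCategory D.FullSubcategory where
  rightDual X :=
    { rightDual := ⟨X.objᘁ, IsTensorSubcategory.prop_rightDual _ X.property⟩
      exact := exactPairingFull D X ⟨X.objᘁ, _⟩ }
  leftDual X :=
    { leftDual := ⟨(ᘁX.obj : C), IsTensorSubcategory.prop_leftDual _ X.property⟩
      exact := exactPairingFull D ⟨(ᘁX.obj : C), _⟩ X }

/-- The reversed category of a left rigid category is right rigid: the right dual of an object in
the reversed category is its left dual in the original category. -/
instance rightRigidMop : RightRigidCategory Cᴹᵒᵖ where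
  rightDual X :=
    { rightDual := mop (ᘁ(unmop X) : C)
      exact :=
        { coevaluation' := (η_ (ᘁ(unmop X) : C) (unmop X)).mop
          evaluation' := (ε_ (ᘁ(unmop X) : C) (unmop X)).mop
          coevaluation_evaluation' := Quiver.Hom.unmop_inj
            (ExactPairing.evaluation_coevaluation (ᘁ(unmop X) : C) (unmop X))
          evaluation_coevaluation' := Quiver.Hom.unmop_inj
            (ExactPairing.coevaluation_evaluation (ᘁ(unmop X) : C) (unmop X)) } }

/-- The left action of the reversed category `D.FullSubcategoryᴹᵒᵖ` of a full monoidal subcategory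
on the ambient category by tensoring on the right: `X` sends `M` to `M ⊗ X`. -/
instance revAction (D : ObjectProperty C) [D.IsMonoidal] :
    MonoidalLeftAction (D.FullSubcategoryᴹᵒᵖ) C where
  actionObj X M := M ⊗ (unmop X).obj
  actionHomLeft f M := M ◁ f.unmop.hom
  actionHomRight X _ _ g := g ▷ (unmop X).obj
  actionHom f g := g ⊗ₘ f.unmop.hom
  actionAssocIso X Y M := (α_ M (unmop Y).obj (unmop X).obj).symm
  actionUnitIso M := ρ_ M
  actionHom_def f g := MonoidalCategory.tensorHom_def' _ _
  actionHomRight_id _ _ := id_whiskerRight _ _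
  id_actionHomLeft _ _ := whiskerLeft_id _ _
  actionHom_comp f₁ f₂ g₁ g₂ := (tensorHom_comp_tensorHom g₁ f₁.unmop.hom g₂ f₂.unmop.hom).symm
  actionAssocIso_hom_naturality f g h :=
    associator_inv_naturality h g.unmop.hom f.unmop.hom
  actionUnitIso_hom_naturality f := (rightUnitor_naturality f).symm
  whiskerLeft_actionHomLeft X _ _ f M := by
    change M ◁ (f.unmop.hom ▷ (unmop X).obj) = (α_ _ _ _).inv ≫ (M ◁ f.unmop.hom) ▷ _ ≫ (α_ _ _ _).hom
    simp
  whiskerRight_actionHomLeft X f M := by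
    change M ◁ ((unmop X).obj ◁ f.unmop.hom) = (α_ _ _ _).inv ≫ (M ⊗ _) ◁ f.unmop.hom ≫ (α_ _ _ _).hom
    simp
  associator_actionHom X Y Z M := by
    change M ◁ (α_ (unmop Z).obj (unmop Y).obj (unmop X).obj).inv ≫ (α_ _ _ _).inv ≫
      (α_ _ _ _).inv ▷ _ = (α_ _ _ _).inv ≫ (α_ _ _ _).inv
    exact pentagon_inv
  leftUnitor_actionHom X M := by
    change M ◁ (ρ_ (unmop X).obj).hom = (α_ _ _ _).inv ≫ (ρ_ _).hom
    simp
  rightUnitor_actionHom X M := by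
    change M ◁ (λ_ (unmop X).obj).hom = (α_ _ _ _).inv ≫ (ρ_ _).hom ▷ _
    simp

end Rigid

/-! ### Relative ends -/

section RelativeEnd

variable {V : Type w} [Category.{v'} V] [MonoidalCategory V] [RightRigidCategory V]
  {M : Type u} [Category.{v} M] [MonoidalLeftAction V M] {B : Type u'} [Category.{v} B]

/-- A prebalancing of a functor `S : Mᵒᵖ × M ⥤ B` with respect to an action of `V` on `M`: natural
isomorphisms `S (m, X ▹ n) ≅ S (X* ▹ m, n)`. -/
structure Prebalancing (V : Type w) [Category.{v'} V] [MonoidalCategory V] [RightRigidCategory V]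
    {M : Type u} [Category.{v} M] [MonoidalLeftAction V M] {B : Type u'} [Category.{v} B]
    (S : Mᵒᵖ ⥤ M ⥤ B) where
  iso : ∀ (X : V) (m n : M),
    (S.obj (op m)).obj (X ⊙ₗ n) ≅ (S.obj (op (Xᘁ ⊙ₗ m))).obj n
  natural_left : ∀ (X : V) {m m' : M} (f : m ⟶ m') (n : M),
    (S.map f.op).app (X ⊙ₗ n) ≫ (iso X m n).hom =
      (iso X m' n).hom ≫ (S.map (Xᘁ ⊴ₗ f).op).app n
  natural_right : ∀ (X : V) (m : M) {n n' : M} (g : n ⟶ n'),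
    (S.obj (op m)).map (X ⊴ₗ g) ≫ (iso X m n').hom =
      (iso X m n).hom ≫ (S.obj (op (Xᘁ ⊙ₗ m))).map g
  natural : ∀ {X X' : V} (h : X ⟶ X') (m n : M),
    (S.obj (op m)).map (h ⊵ₗ n) ≫ (iso X' m n).hom =
      (iso X m n).hom ≫ (S.map ((hᘁ) ⊵ₗ m).op).app n

/-- A dinatural transformation from an object `E` to `S`. -/
def IsDinatural (S : Mᵒᵖ ⥤ M ⥤ B) (E : B) (π : ∀ m : M, E ⟶ (S.obj (op m)).obj m) : Prop :=
  ∀ ⦃m n : M⦄ (f : m ⟶ n), π m ≫ (S.obj (op m)).map f = π n ≫ (S.map f.op).app n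

/-- The compatibility of a family `π m : E ⟶ S (m, m)` with the prebalancing `β`:
`S (ev_X ▹ m, m) ∘ π m = S (a_{X*, X, m}, m) ∘ β ∘ π (X ▹ m)` for all `X` in `V` and `m` in `M`, as
morphisms to `S ((X* ⊗ X) ▹ m, m)`, where `a` is the associativity of the action. -/
def Prebalancing.IsCompatible {S : Mᵒᵖ ⥤ M ⥤ B} (β : Prebalancing V S) (E : B)
    (π : ∀ m : M, E ⟶ (S.obj (op m)).obj m) : Prop :=
  ∀ (X : V) (m : M),
    π m ≫ (S.map ((ε_ X (Xᘁ : V) ⊵ₗ m) ≫ (λₗ m).hom).op).app m =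
      π (X ⊙ₗ m) ≫ (β.iso X (X ⊙ₗ m) m).hom ≫ (S.map (αₗ (Xᘁ : V) X m).hom.op).app m

/-- An end of `S`: an object with a universal dinatural transformation to `S`. -/
structure IsEnd (S : Mᵒᵖ ⥤ M ⥤ B) (E : B) (π : ∀ m : M, E ⟶ (S.obj (op m)).obj m) : Prop where
  dinatural : IsDinatural S E π
  existsUnique : ∀ (E' : B) (π' : ∀ m : M, E' ⟶ (S.obj (op m)).obj m), IsDinatural S E' π' →
    ∃! h : E' ⟶ E, ∀ m : M, h ≫ π m = π' m

/-- A relative end of `(S, β)`: an object with a universal dinatural transformation to `S` among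
those that are compatible with `β`. -/
structure Prebalancing.IsRelativeEnd {S : Mᵒᵖ ⥤ M ⥤ B} (β : Prebalancing V S) (E : B)
    (π : ∀ m : M, E ⟶ (S.obj (op m)).obj m) : Prop where
  dinatural : IsDinatural S E π
  compatible : β.IsCompatible E π
  existsUnique : ∀ (E' : B) (π' : ∀ m : M, E' ⟶ (S.obj (op m)).obj m), IsDinatural S E' π' →
    β.IsCompatible E' π' → ∃! h : E' ⟶ E, ∀ m : M, h ≫ π m = π' m

end RelativeEnd

/-! ### The internal Hom of the regular module category -/

section InternalHom

variable {C : Type u} [Category.{v} C] [MonoidalCategory C] [RightRigidCategory C]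

/-- The internal Hom `N ⊗ M*` of the left module category `C` over itself. -/
abbrev ihomObj (M N : C) : C := N ⊗ Mᘁ

/-- The bijections `Hom (X ⊗ M, N) ≃ Hom (X, N ⊗ M*)` of the internal Hom. -/
abbrev ψ (X M N : C) : (X ⊗ M ⟶ N) ≃ (X ⟶ ihomObj M N) := tensorRightHomEquiv X M (Mᘁ) N

variable (C) in
/-- The bifunctor `S (M, N) = N ⊗ M*`. -/
@[simps]
def ihomFunctor : Cᵒᵖ ⥤ C ⥤ C where
  obj M :=
    { obj := fun N => ihomObj M.unop N
      map := fun g => g ▷ (M.unop)ᘁ }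
  map f :=
    { app := fun N => N ◁ (f.unopᘁ)
      naturality := fun _ _ g => (whisker_exchange g (f.unopᘁ)).symm }
  map_id M := by ext N; simp
  map_comp f g := by ext N; simp [comp_rightAdjointMate]

/-- The evaluation of the internal Hom. -/
def ihomEv (M N : C) : ihomObj M N ⊗ M ⟶ N := (ψ (ihomObj M N) M N).symm (𝟙 _)

/-- The coevaluation of the internal Hom. -/
def ihomCoev (M : C) : 𝟙_ C ⟶ ihomObj M M := ψ (𝟙_ C) M M (λ_ M).hom

/-- The composition of the internal Hom. -/
def ihomComp (M : C) : ihomObj M M ⊗ ihomObj M M ⟶ ihomObj M M :=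
  ψ (ihomObj M M ⊗ ihomObj M M) M M
    ((α_ _ _ _).hom ≫ ihomObj M M ◁ ihomEv M M ≫ ihomEv M M)

/-- The isomorphism `Hom (M, X ⊗ N) ≅ X ⊗ Hom (M, N)` of internal Homs. -/
def ihomA (X M N : C) : ihomObj M (X ⊗ N) ⟶ X ⊗ ihomObj M N := (α_ X N (Mᘁ)).hom

/-- The morphism `Hom (X ⊗ M, N) ⟶ Hom (M, N) ⊗ X*` of internal Homs which corresponds to the
natural bijections `Hom (Z, Hom (X ⊗ M, N)) ≃ Hom (Z ⊗ (X ⊗ M), N) ≃ Hom ((Z ⊗ X) ⊗ M, N) ≃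
Hom (Z ⊗ X, Hom (M, N)) ≃ Hom (Z, Hom (M, N) ⊗ X*)`. -/
def ihomB₁ (X M N : C) : ihomObj (X ⊗ M) N ⟶ ihomObj M N ⊗ Xᘁ :=
  tensorRightHomEquiv _ X (Xᘁ) _ (ψ (ihomObj (X ⊗ M) N ⊗ X) M N
    ((α_ _ _ _).hom ≫ ihomEv (X ⊗ M) N))

/-- The morphism `Hom (X ⊗ M, N) ⊗ X ⟶ Hom (M, N)` of internal Homs. -/
def ihomB (X M N : C) : ihomObj (X ⊗ M) N ⊗ X ⟶ ihomObj M N :=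
  ihomB₁ X M N ▷ X ≫ (α_ _ _ _).hom ≫ ihomObj M N ◁ ε_ X (Xᘁ) ≫ (ρ_ _).hom

end InternalHom

/-! ### Adjoint algebras -/

section Algebras

/-- The half-braiding, the product and the unit of an algebra `A` in the center of `C` are the ones
determined by a wedge `π M : A ⟶ Hom (M, M)` with values in the internal Homs. -/
structure IsDeterminedBy {C : Type u} [Category.{v} C] [MonoidalCategory C] [RightRigidCategory C]
    (A : Mon (Center C)) (π : ∀ M : C, A.X.1 ⟶ ihomObj M M) : Prop where
  halfBraiding : ∀ X M : C, (A.X.2.β X).hom ≫ X ◁ π M =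
    π (X ⊗ M) ▷ X ≫ ihomB X M (X ⊗ M) ≫ ihomA X M M
  mul : ∀ M : C, (μ[A.X]).f ≫ π M = (π M ⊗ₘ π M) ≫ ihomComp M
  one : ∀ M : C, (η[A.X]).f ≫ π M = ihomCoev M

/-- The adjoint algebra of `C`: an algebra in the center of `C` whose underlying object is the end
of `M ⊗ M*`, with the half-braiding, product and unit determined by the end. -/
structure AdjointAlgebra (C : Type u) [Category.{v} C] [MonoidalCategory C]
    [RightRigidCategory C] where
  alg : Mon (Center C)
  π : ∀ M : C, alg.X.1 ⟶ ihomObj M M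
  isEnd : IsEnd (ihomFunctor C) alg.X.1 π
  isDeterminedBy : IsDeterminedBy alg π

theorem rightAdjointMate_unique {C : Type u} [Category.{v} C] [MonoidalCategory C] {X Y : C}
    (p : HasRightDual X) (q : HasRightDual Y) (f : X ⟶ Y) (g : Yᘁ ⟶ Xᘁ)
    (h : η_ Y (Yᘁ) ≫ Y ◁ g = η_ X (Xᘁ) ≫ f ▷ _) : (fᘁ) = g := by
  rw [← coevaluation_comp_rightAdjointMate] at h
  have := congrArg (tensorLeftHomEquiv _ Y (Yᘁ) _).symm h
  simpa using this.symm

variable {C : Type u} [Category.{v} C] [MonoidalCategory C] [RigidCategory C]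

/-- The canonical isomorphism `φ : (M ⊗ *X)* ≅ X ⊗ M*`. -/
def dualIso (M X : C) : (M ⊗ (ᘁX : C))ᘁ ≅ X ⊗ Mᘁ :=
  rightDualIso (RightRigidCategory.rightDual _).exact
    (ExactPairing.tensor (X₁ := M) (X₂ := (ᘁX : C)) (Y₁ := Mᘁ) (Y₂ := X))

theorem dualIso_natural_left {M M' : C} (f : M ⟶ M') (X : C) :
    X ◁ (fᘁ) ≫ (dualIso M X).inv = (dualIso M' X).inv ≫ ((f ▷ (ᘁX : C))ᘁ) := by
  let p : HasRightDual (M ⊗ (ᘁX : C)) := @HasRightDual.mk _ _ _ _ (X ⊗ Mᘁ) ExactPairing.tensor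
  let p' : HasRightDual (M' ⊗ (ᘁX : C)) := @HasRightDual.mk _ _ _ _ (X ⊗ M'ᘁ) ExactPairing.tensor
  have key : @rightAdjointMate _ _ _ _ _ p p' (f ▷ (ᘁX : C)) = X ◁ (fᘁ) := by
    apply rightAdjointMate_unique
    change η_ (M' ⊗ (ᘁX : C)) (X ⊗ M'ᘁ) ≫ (M' ⊗ (ᘁX : C)) ◁ X ◁ (fᘁ) =
      η_ (M ⊗ (ᘁX : C)) (X ⊗ Mᘁ) ≫ (f ▷ (ᘁX : C)) ▷ (X ⊗ Mᘁ)
    rw [ExactPairing.tensor_coevaluation, ExactPairing.tensor_coevaluation]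
    calc _ = η_ M' (M'ᘁ) ⊗≫ ((M' ◁ η_ (ᘁX : C) X) ▷ (M'ᘁ) ≫ (M' ⊗ (ᘁX : C) ⊗ X) ◁ (fᘁ)) ⊗≫ 𝟙 _ := by
          monoidal
      _ = (η_ M' (M'ᘁ) ≫ M' ◁ (fᘁ)) ⊗≫ (M' ◁ η_ (ᘁX : C) X) ▷ (Mᘁ) ⊗≫ 𝟙 _ := by
          rw [← whisker_exchange]; monoidal
      _ = η_ M (Mᘁ) ⊗≫ (f ▷ 𝟙_ C ≫ M' ◁ η_ (ᘁX : C) X) ▷ (Mᘁ) ⊗≫ 𝟙 _ := by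
          rw [coevaluation_comp_rightAdjointMate]; monoidal
      _ = _ := by
          rw [← whisker_exchange]; monoidal
  rw [← key]
  dsimp only [dualIso, rightDualIso]
  erw [← @comp_rightAdjointMate, ← @comp_rightAdjointMate]
  simp

theorem dualIso_natural_right (M : C) {X X' : C} (f : X ⟶ X') :
    f ▷ Mᘁ ≫ (dualIso M X').inv = (dualIso M X).inv ≫ ((M ◁ (ᘁf))ᘁ) := by
  let p : HasRightDual (M ⊗ (ᘁX : C)) := @HasRightDual.mk _ _ _ _ (X ⊗ Mᘁ) ExactPairing.tensor
  let p' : HasRightDual (M ⊗ (ᘁX' : C)) := @HasRightDual.mk _ _ _ _ (X' ⊗ Mᘁ) ExactPairing.tensor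
  have key : @rightAdjointMate _ _ _ _ _ p' p (M ◁ (ᘁf)) = f ▷ Mᘁ := by
    apply rightAdjointMate_unique
    change η_ (M ⊗ (ᘁX : C)) (X ⊗ Mᘁ) ≫ (M ⊗ (ᘁX : C)) ◁ f ▷ Mᘁ =
      η_ (M ⊗ (ᘁX' : C)) (X' ⊗ Mᘁ) ≫ (M ◁ (ᘁf)) ▷ (X' ⊗ Mᘁ)
    rw [ExactPairing.tensor_coevaluation, ExactPairing.tensor_coevaluation]
    calc _ = η_ M (Mᘁ) ⊗≫ (M ◁ (η_ (ᘁX : C) X ≫ (ᘁX : C) ◁ f)) ▷ (Mᘁ) ⊗≫ 𝟙 _ := by monoidal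
      _ = _ := by
          rw [← coevaluation_comp_leftAdjointMate]
          monoidal
  rw [← key]
  dsimp only [dualIso, rightDualIso]
  erw [← @comp_rightAdjointMate, ← @comp_rightAdjointMate]
  simp

/-- The prebalancing `β : (N ⊗ X) ⊗ M* ≅ N ⊗ (M ⊗ *X)*` of the bifunctor `S (M, N) = N ⊗ M*` with
respect to the action of the reversed category of `D` by tensoring on the right. -/
def revPrebalancing (D : ObjectProperty C) [IsTensorSubcategory D] :
    Prebalancing (D.FullSubcategoryᴹᵒᵖ) (ihomFunctor C) where
  iso X M N := α_ N (unmop X).obj (Mᘁ) ≪≫ whiskerLeftIso N (dualIso M (unmop X).obj).symm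
  natural_left X M M' f N := by
    change (N ⊗ (unmop X).obj) ◁ (fᘁ) ≫ (α_ _ _ _).hom ≫ N ◁ (dualIso M (unmop X).obj).inv =
      ((α_ _ _ _).hom ≫ N ◁ (dualIso M' (unmop X).obj).inv) ≫ N ◁ ((f ▷ (ᘁ(unmop X).obj : C))ᘁ)
    rw [Category.assoc, ← whiskerLeft_comp, ← dualIso_natural_left]
    simp
  natural_right X M N N' g := by
    change (g ▷ (unmop X).obj) ▷ Mᘁ ≫ (α_ _ _ _).hom ≫ N' ◁ (dualIso M (unmop X).obj).inv =
      ((α_ _ _ _).hom ≫ N ◁ (dualIso M (unmop X).obj).inv) ≫ g ▷ _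
    have := whisker_exchange g (dualIso M (unmop X).obj).inv
    rw [Category.assoc]
    refine Eq.trans ?_ (congrArg (fun t => (α_ N (unmop X).obj (Mᘁ)).hom ≫ t) this.symm)
    simp
  natural {X X'} h M N := by
    change (N ◁ h.unmop.hom) ▷ Mᘁ ≫ (α_ _ _ _).hom ≫ N ◁ (dualIso M (unmop X').obj).inv =
      ((α_ _ _ _).hom ≫ N ◁ (dualIso M (unmop X).obj).inv) ≫ N ◁ ((M ◁ (ᘁ(h.unmop.hom)))ᘁ)
    rw [Category.assoc, ← whiskerLeft_comp, ← dualIso_natural_right]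
    simp

/-- The relative adjoint algebra of the tensor subcategory `D` of `C`, i.e. the adjoint algebra of
the regular module category `C` relative to the reversed category of `D`: an algebra in the center
of `C` whose underlying object is the relative end of `M ⊗ M*`, with the half-braiding, product and
unit determined by the relative end. -/
structure RelativeAdjointAlgebra (D : ObjectProperty C) [IsTensorSubcategory D] where
  alg : Mon (Center C)
  α : ∀ M : C, alg.X.1 ⟶ ihomObj M M
  isRelativeEnd : (revPrebalancing D).IsRelativeEnd alg.X.1 α
  isDeterminedBy : IsDeterminedBy alg α

/-- The underlying algebra in `C` of an algebra in the center of `C`. -/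
noncomputable abbrev underlying {C : Type u} [Category.{v} C] [MonoidalCategory C] (A : Mon (Center C)) : Mon C :=
  (Center.forget C).mapMon.obj A

/-- The algebra in `C` given by an algebra in a full monoidal subcategory. -/
abbrev ambient {C : Type u} [Category.{v} C] [MonoidalCategory C] (D : ObjectProperty C)
    [D.IsMonoidal] (A : Mon D.FullSubcategory) : Mon C :=
  D.ι.mapMon.obj A

end Algebras

end AdjointAlgebras

/-! Transposing along `ψ` turns a family E ⟶ M ⊗ M* into a family θ_M : E ⊗ M ⟶ M. Dinaturality
becomes naturality in M (`isDinatural_iff`), and compatibility with the prebalancing becomes θ_{M ⊗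
X} = θ_M ⊗ X for X in D (`isCompatible_iff`). So A_C is the universal object acting naturally on the
objects of C, and A(D) is the universal one acting compatibly with tensoring by D on the right. Both
are instances of `IsUniversalAction J`, with J = ⊥ and J = D. The product comes from acting twice,
the unit from the trivial action, the half-braiding from θ_{X ⊗ M}; all axioms are checked by
letting both sides act on every M.

The morphism ι exists because α is in particular dinatural, and q because π restricted to D is
dinatural. For Y in D, compatibility at M = 𝟙 gives θ_Y = θ_𝟙 ⊗ Y, so A(D) acts on Y only through
α_𝟙 (`comp_ihomCoev_eq`). This is the identity for q ∘ ι.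

Existence rests on finiteness. If P separates morphisms, a dinatural family is detected by its
component at P, so the end is the largest subobject of P ⊗ P* carrying such a family
(`exists_universal_family`). For D, P is replaced by its largest quotient Q in D. The end is then a
subobject of Q ⊗ Q*, hence lies in D, and it is universal even for test objects of C, as q requires.
-/

namespace AdjointAlgebras

/-! ### Universal families and separators in abelian categories -/

section Abelian

variable {C : Type u} [Category.{v} C] [Abelian C]

/-- The families of morphisms `E ⟶ T i` out of a variable object that satisfy given equations
`π (s r) ≫ a r = π (t r) ≫ b r` are represented by a subobject of a noetherian object `T i₀`, if
they are detected by the component at `i₀`. -/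
theorem exists_universal_family {I R : Type*} (T : I → C) {s t : R → I} {W : R → C}
    (a : ∀ r, T (s r) ⟶ W r) (b : ∀ r, T (t r) ⟶ W r) (i₀ : I) [IsNoetherianObject (T i₀)]
    (detect : ∀ (E : C) (π : ∀ i, E ⟶ T i), (∀ r, π (s r) ≫ a r = π (t r) ≫ b r) →
      π i₀ = 0 → ∀ i, π i = 0) :
    ∃ (A : C) (π : ∀ i, A ⟶ T i), Mono (π i₀) ∧ (∀ r, π (s r) ≫ a r = π (t r) ≫ b r) ∧
      ∀ (E : C) (π' : ∀ i, E ⟶ T i), (∀ r, π' (s r) ≫ a r = π' (t r) ≫ b r) →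
        ∃ h : E ⟶ A, ∀ i, h ≫ π i = π' i := by
  -- Beyond `detect`, the argument uses only that good families contain zero and are stable under
  -- precomposition, descent along epimorphisms and binary sums.
  obtain ⟨good, hgood⟩ : ∃ good : ∀ E : C, (∀ i, E ⟶ T i) → Prop,
      ∀ E π, good E π ↔ ∀ r, π (s r) ≫ a r = π (t r) ≫ b r := ⟨_, fun _ _ => Iff.rfl⟩
  simp only [← hgood] at detect ⊢
  have good_zero : ∀ E : C, good E (fun _ => 0) := fun E => (hgood _ _).2 fun r => by simp
  have good_precomp : ∀ {E E' : C} (h : E' ⟶ E) (π : ∀ i, E ⟶ T i), good E π →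
      good E' (fun i => h ≫ π i) := fun h π hπ => (hgood _ _).2 fun r => by
    rw [Category.assoc, (hgood _ _).1 hπ r, Category.assoc]
  have good_descent : ∀ {E E' : C} (e : E' ⟶ E) [Epi e] (π : ∀ i, E ⟶ T i),
      good E' (fun i => e ≫ π i) → good E π := fun e _ π hπ => (hgood _ _).2 fun r => by
    simpa only [Category.assoc, cancel_epi] using (hgood _ _).1 hπ r
  have good_desc : ∀ {E E' : C} (π : ∀ i, E ⟶ T i) (π' : ∀ i, E' ⟶ T i), good E π → good E' π' →
      good (E ⊞ E') (fun i => biprod.desc (π i) (π' i)) :=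
    fun π π' hπ hπ' => (hgood _ _).2 fun r => by
      apply biprod.hom_ext'
      · simpa using (hgood _ _).1 hπ r
      · simpa using (hgood _ _).1 hπ' r
  -- A good family descends to the image of its component at `i₀`: on the kernel of that component
  -- the whole family vanishes by `detect`.
  have fact : ∀ (E : C) (π : ∀ i, E ⟶ T i), good E π →
      ∃ π' : ∀ i, image (π i₀) ⟶ T i, good _ π' ∧ π' i₀ = image.ι (π i₀) ∧
        ∀ i, factorThruImage (π i₀) ≫ π' i = π i := by
    intro E π hπ
    have hk : ∀ i, kernel.ι (factorThruImage (π i₀)) ≫ π i = 0 := by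
      apply detect _ _ (good_precomp _ _ hπ)
      conv_lhs => arg 2; rw [← image.fac (π i₀)]
      rw [kernel.condition_assoc, zero_comp]
    have hfac : ∀ i, factorThruImage (π i₀) ≫
        Abelian.epiDesc (factorThruImage (π i₀)) (π i) (hk i) = π i :=
      fun i => Abelian.comp_epiDesc _ _ _
    refine ⟨fun i => Abelian.epiDesc (factorThruImage (π i₀)) (π i) (hk i), ?_, ?_, hfac⟩
    · refine good_descent (factorThruImage (π i₀)) _ ?_
      simpa only [hfac] using hπ
    · rw [← cancel_epi (factorThruImage (π i₀)), hfac, image.fac]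
  let S : Set (Subobject (T i₀)) :=
    {K | ∃ π : ∀ i, (K : C) ⟶ T i, good _ π ∧ π i₀ = K.arrow}
  have hmem : ∀ (E : C) (π : ∀ i, E ⟶ T i), good E π → imageSubobject (π i₀) ∈ S := by
    intro E π hπ
    obtain ⟨π', h1, h2, -⟩ := fact E π hπ
    refine ⟨fun i => (imageSubobjectIso (π i₀)).hom ≫ π' i, good_precomp _ _ h1, ?_⟩
    dsimp only
    rw [h2, imageSubobject_arrow]
  -- A minimum for the relation `>` is a maximal subobject; the zero family shows that `S` is
  -- nonempty.
  obtain ⟨K, ⟨π, hπ, hK⟩, hmax⟩ := WellFounded.has_min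
    (wellFounded_gt (α := Subobject (T i₀))) S ⟨_, hmem (T i₀) (fun _ => 0) (good_zero _)⟩
  refine ⟨K, π, by rw [hK]; infer_instance, hπ, fun E π' hπ' => ?_⟩
  -- The sum with any other good family has an image containing `K`, hence equal to `K` by
  -- maximality, so `π' i₀` factors through `K`.
  have hsum := good_desc π π' hπ hπ'
  have hle : K ≤ imageSubobject (biprod.desc (π i₀) (π' i₀)) := by
    refine Subobject.le_of_comm
      (biprod.inl ≫ factorThruImageSubobject (biprod.desc (π i₀) (π' i₀))) ?_
    simp [hK]
  have heq : K = imageSubobject (biprod.desc (π i₀) (π' i₀)) := by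
    by_contra hne
    exact hmax _ (hmem _ _ hsum) (lt_of_le_of_ne hle hne)
  have hfac : K.Factors (π' i₀) := by
    rw [heq]
    have := imageSubobject_factors_comp_self (f := biprod.desc (π i₀) (π' i₀))
      (biprod.inr : E ⟶ _)
    rwa [biprod.inr_desc] at this
  refine ⟨K.factorThru _ hfac, fun i => ?_⟩
  -- The difference of the two families is good and vanishes at `i₀`, hence vanishes everywhere.
  have hg : good E (fun i => biprod.lift (K.factorThru _ hfac) (-𝟙 E) ≫
      biprod.desc (π i) (π' i)) := good_precomp _ _ hsum
  have := detect _ _ hg (by simp [hK]) i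
  simpa [add_neg_eq_zero] using this

/-- `P` separates morphisms out of `Y`. -/
def SeparatesFrom (P Y : C) : Prop :=
  ∀ ⦃Z : C⦄ (g : Y ⟶ Z), (∀ f : P ⟶ Y, f ≫ g = 0) → g = 0

/-- The noetherian condition provides a maximal proper subobject, and the quotient by it is simple.
-/
theorem exists_epi_to_simple (X : C) [IsNoetherianObject X] (hX : ¬ IsZero X) :
    ∃ (S : C) (p : X ⟶ S), Simple S ∧ Epi p := by
  have : Nontrivial (Subobject X) := by
    by_contra h
    rw [not_nontrivial_iff_subsingleton] at h
    apply hX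
    rw [IsZero.iff_id_eq_zero]
    have h0 : (⊤ : Subobject X) = ⊥ := Subsingleton.elim _ _
    rw [← Subobject.bot_factors_iff_zero (f := 𝟙 X), ← h0]
    exact Subobject.top_factors _
  obtain ⟨K, hK, -⟩ := (eq_top_or_exists_le_coatom (⊥ : Subobject X)).resolve_left bot_ne_top
  refine ⟨cokernel K.arrow, cokernel.π K.arrow, ?_, inferInstance⟩
  apply simple_of_cosimple
  intro Z f _
  have hle : K ≤ kernelSubobject (cokernel.π K.arrow ≫ f) := by
    apply le_kernelSubobject
    simp
  constructor
  · intro _ h0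
    subst h0
    have hz : cokernel.π K.arrow = 0 := by
      rw [← cancel_mono (0 : cokernel K.arrow ⟶ Z)]; simp
    have : Epi K.arrow := Preadditive.epi_of_cokernel_zero hz
    have : IsIso K.arrow := isIso_of_mono_of_epi _
    exact hK.1 (Subobject.eq_top_of_isIso_arrow K)
  · intro hf
    -- The kernel of the composite contains the coatom `K`: if it equals `K`, then `f` is mono;
    -- otherwise it is everything and `f` is zero.
    rcases hle.eq_or_lt with h | h
    · have : Mono f := by
        refine Preadditive.mono_of_cancel_zero f fun {W} t ht => ?_
        obtain ⟨W', e, _, s, hs⟩ :=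
          surjective_up_to_refinements_of_epi (cokernel.π K.arrow) t
        have hsK : K.Factors s := by
          rw [h, kernelSubobject_factors_iff, ← Category.assoc, ← hs, Category.assoc, ht,
            comp_zero]
        rw [← cancel_epi e, hs, comp_zero, ← Subobject.factorThru_arrow K s hsK, Category.assoc,
          cokernel.condition, comp_zero]
      exact isIso_of_mono_of_epi _
    · exfalso
      apply hf
      have h1 := hK.2 _ h
      rw [← cancel_epi (cokernel.π K.arrow), comp_zero]
      have : (kernelSubobject (cokernel.π K.arrow ≫ f)).Factors (𝟙 X) := by
        rw [h1]
        exact Subobject.top_factors _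
      simpa using (kernelSubobject_factors_iff _ _).1 this

/-- A noetherian abelian category with enough projectives and finitely many simple objects has a
separator. -/
theorem exists_separatesFrom [EnoughProjectives C] [∀ X : C, IsNoetherianObject X] {n : ℕ}
    (S : Fin n → C) (hS : ∀ X : C, Simple X → ∃ i, Nonempty (X ≅ S i)) :
    ∃ P : C, ∀ Y : C, SeparatesFrom P Y := by
  have : HasFiniteBiproducts C := HasFiniteBiproducts.of_hasFiniteProducts
  refine ⟨⨁ fun i => Projective.over (S i), fun X Y g hg => ?_⟩
  by_contra hne
  have hI : ¬ IsZero (image g) := fun h => hne (by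
    rw [← image.fac g, h.eq_of_src (image.ι g) 0, comp_zero])
  obtain ⟨S', p, hS', hp⟩ := exists_epi_to_simple (image g) hI
  obtain ⟨i, ⟨e⟩⟩ := hS S' hS'
  -- By projectivity the epimorphism `q` onto a simple quotient of the image of `g` lifts to `f`
  -- into `X`. As `g` kills every such lift, `q` would be zero.
  let q : Projective.over (S i) ⟶ S' := Projective.π (S i) ≫ e.inv
  let f : Projective.over (S i) ⟶ X := Projective.factorThru q (factorThruImage g ≫ p)
  have hf : f ≫ factorThruImage g ≫ p = q := Projective.factorThru_comp _ _
  have h0 : biproduct.π (fun i => Projective.over (S i)) i ≫ f ≫ factorThruImage g = 0 := by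
    rw [← cancel_mono (image.ι g)]
    simpa using hg (biproduct.π (fun i => Projective.over (S i)) i ≫ f)
  have hq : q = 0 := by
    rw [← hf, ← cancel_epi (biproduct.π (fun i => Projective.over (S i)) i), reassoc_of% h0]
    simp
  exact Simple.not_isZero S' (IsZero.of_epi_eq_zero q hq)

-- The object `Q` is the largest quotient of `P` in `D`, with minimal kernel by the artinian
-- condition. For `f : P ⟶ Y` with `Y` in `D`, the image of `(p, f)` in `Q ⊞ Y` is again a quotient
-- in `D`, so minimality forces `f` to kill the kernel of `p` and to factor through `Q`.
open ZeroObject in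
theorem exists_separatesFrom_of_prop (D : ObjectProperty C) [D.IsClosedUnderSubobjects]
    [D.IsClosedUnderFiniteProducts] (P : C) [IsArtinianObject P]
    (hP : ∀ Y : C, D Y → SeparatesFrom P Y) :
    ∃ Q : C, D Q ∧ ∀ Y : C, D Y → SeparatesFrom Q Y := by
  have hzero : D 0 := D.prop_of_isTerminal _ (isZero_zero C).isTerminal
  let T : Set (Subobject P) :=
    {K | ∃ (Q : C) (p : P ⟶ Q), D Q ∧ Epi p ∧ kernelSubobject p = K}
  obtain ⟨K, ⟨Q, p, hQ, hp, hK⟩, hmin⟩ := WellFounded.has_min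
    (wellFounded_lt (α := Subobject P)) T ⟨_, 0, 0, hzero, inferInstance, rfl⟩
  refine ⟨Q, hQ, fun Y hY Z g hg => hP Y hY g fun f => ?_⟩
  have hD : D (image (biprod.lift p f)) :=
    D.prop_of_mono (image.ι (biprod.lift p f)) (D.prop_of_iso (biprod.isoProd Q Y).symm
      (D.prop_prod _ _ hQ hY))
  have hle : kernelSubobject (factorThruImage (biprod.lift p f)) ≤ K := by
    rw [← hK]
    apply le_kernelSubobject
    have : p = factorThruImage (biprod.lift p f) ≫ image.ι _ ≫ biprod.fst := by simp
    conv_lhs => arg 2; rw [this]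
    rw [kernelSubobject_arrow_comp_assoc, zero_comp]
  have heq : kernelSubobject (factorThruImage (biprod.lift p f)) = K := by
    by_contra hne
    exact hmin _ ⟨_, _, hD, inferInstance, rfl⟩ (lt_of_le_of_ne hle hne)
  have hpf : kernel.ι p ≫ f = 0 := by
    have h1 : (kernelSubobject p).Factors (kernel.ι p) :=
      (kernelSubobject_factors_iff _ _).2 (kernel.condition p)
    rw [hK, ← heq, kernelSubobject_factors_iff] at h1
    have : f = factorThruImage (biprod.lift p f) ≫ image.ι _ ≫ biprod.snd := by simp
    rw [this, reassoc_of% h1, zero_comp]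
  rw [← Abelian.comp_epiDesc p f hpf, Category.assoc, hg, comp_zero]

end Abelian

/-! ### Invertibility of lax half-braidings -/

section LaxHalfBraiding

variable {C : Type u} [Category.{v} C] [MonoidalCategory C]

/-- The candidate for the inverse of a lax half-braiding in the presence of duals. -/
def laxHalfBraidingInv {A : C} (σ : ∀ X : C, A ⊗ X ⟶ X ⊗ A) (Y X : C) [ExactPairing Y X] :
    X ⊗ A ⟶ A ⊗ X :=
  (ρ_ _).inv ≫ (X ⊗ A) ◁ η_ Y X ⊗≫ X ◁ σ Y ▷ X ⊗≫ ε_ Y X ▷ (A ⊗ X) ⊗≫ 𝟙 _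

/-- A natural family `A ⊗ X ⟶ X ⊗ A` which is compatible with tensor products and the unit object
consists of isomorphisms, if all objects have duals. -/
theorem isIso_laxHalfBraiding {A : C} (σ : ∀ X : C, A ⊗ X ⟶ X ⊗ A)
    (natural : ∀ {X Y : C} (f : X ⟶ Y), A ◁ f ≫ σ Y = σ X ≫ f ▷ A)
    (tensor : ∀ X Y : C, σ (X ⊗ Y) =
      (α_ _ _ _).inv ≫ σ X ▷ Y ≫ (α_ _ _ _).hom ≫ X ◁ σ Y ≫ (α_ _ _ _).inv)
    (unit : σ (𝟙_ C) = (ρ_ A).hom ≫ (λ_ A).inv) (Y X : C) [ExactPairing Y X] : IsIso (σ X) := by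
  refine ⟨laxHalfBraidingInv σ Y X, ?_, ?_⟩
  -- The components at `X` and `Y` merge into the one at `X ⊗ Y`; naturality carries the evaluation
  -- through it, and a zigzag identity remains. The other composite is dual, with the coevaluation.
  · calc
      _ = 𝟙 _ ⊗≫ (σ X ▷ 𝟙_ C ≫ (X ⊗ A) ◁ η_ Y X) ⊗≫ X ◁ σ Y ▷ X ⊗≫ ε_ Y X ▷ (A ⊗ X) ⊗≫ 𝟙 _ := by
        dsimp only [laxHalfBraidingInv]; monoidal
      _ = 𝟙 _ ⊗≫ A ◁ (X ◁ η_ Y X) ⊗≫ ((α_ _ _ _).inv ≫ σ X ▷ Y ≫ (α_ _ _ _).hom ≫ X ◁ σ Y ≫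
            (α_ _ _ _).inv) ▷ X ⊗≫ ε_ Y X ▷ (A ⊗ X) ⊗≫ 𝟙 _ := by
        rw [← whisker_exchange]; monoidal
      _ = 𝟙 _ ⊗≫ A ◁ (X ◁ η_ Y X) ⊗≫ (σ (X ⊗ Y) ≫ ε_ Y X ▷ A) ▷ X ⊗≫ 𝟙 _ := by
        rw [← tensor]; monoidal
      _ = 𝟙 _ ⊗≫ A ◁ (X ◁ η_ Y X ⊗≫ ε_ Y X ▷ X) ⊗≫ 𝟙 _ := by
        rw [← natural, unit]; monoidal
      _ = _ := by
        rw [ExactPairing.coevaluation_evaluation'']; monoidal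
  · calc
      _ = 𝟙 _ ⊗≫ (X ⊗ A) ◁ η_ Y X ⊗≫ X ◁ σ Y ▷ X ⊗≫
            (ε_ Y X ▷ (A ⊗ X) ≫ 𝟙_ C ◁ σ X) ⊗≫ 𝟙 _ := by
        dsimp only [laxHalfBraidingInv]; monoidal
      _ = 𝟙 _ ⊗≫ (X ⊗ A) ◁ η_ Y X ⊗≫ X ◁ ((α_ _ _ _).inv ≫ σ Y ▷ X ≫ (α_ _ _ _).hom ≫ Y ◁ σ X ≫
            (α_ _ _ _).inv) ⊗≫ ε_ Y X ▷ (X ⊗ A) ⊗≫ 𝟙 _ := by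
        rw [← whisker_exchange]; monoidal
      _ = 𝟙 _ ⊗≫ X ◁ (A ◁ η_ Y X ≫ σ (Y ⊗ X)) ⊗≫ ε_ Y X ▷ (X ⊗ A) ⊗≫ 𝟙 _ := by
        rw [← tensor]; monoidal
      _ = 𝟙 _ ⊗≫ (X ◁ η_ Y X ⊗≫ ε_ Y X ▷ X) ▷ A ⊗≫ 𝟙 _ := by
        rw [natural, unit]; monoidal
      _ = _ := by
        rw [ExactPairing.coevaluation_evaluation'']; monoidal

end LaxHalfBraiding

/-! ### Universal actions and their algebra structure in the center -/

section Action

variable {C : Type u} [Category.{v} C] [MonoidalCategory C]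

/-- A natural family `E ⊗ M ⟶ M` which is compatible with the right tensor action of the objects
of `J`. -/
structure IsAction (J : ObjectProperty C) (E : C) (θ : ∀ M : C, E ⊗ M ⟶ M) : Prop where
  natural : ∀ {M N : C} (f : M ⟶ N), E ◁ f ≫ θ N = θ M ≫ f
  module : ∀ M X : C, J X → θ (M ⊗ X) = (α_ E M X).inv ≫ θ M ▷ X

/-- A universal natural family `A ⊗ M ⟶ M` among those which are compatible with the right tensor
action of the objects of `J`. -/
structure IsUniversalAction (J : ObjectProperty C) (A : C) (θ : ∀ M : C, A ⊗ M ⟶ M) : Prop where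
  isAction : IsAction J A θ
  existsUnique : ∀ (E : C) (θ' : ∀ M : C, E ⊗ M ⟶ M), IsAction J E θ' →
    ∃! h : E ⟶ A, ∀ M : C, h ▷ M ≫ θ M = θ' M

namespace IsUniversalAction

variable {J : ObjectProperty C} {A : C} {θ : ∀ M : C, A ⊗ M ⟶ M}

theorem precomp (hA : IsAction J A θ) {E : C} (f : E ⟶ A) :
    IsAction J E (fun M => f ▷ M ≫ θ M) where
  natural g := by
    rw [whisker_exchange_assoc, hA.natural, Category.assoc]
  module M X hX := by
    rw [hA.module M X hX]
    monoidal

variable (hA : IsUniversalAction J A θ)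
include hA

theorem hom_ext {E : C} {f g : E ⟶ A} (h : ∀ M, f ▷ M ≫ θ M = g ▷ M ≫ θ M) : f = g :=
  (hA.existsUnique E _ (precomp hA.isAction g)).unique h fun _ => rfl

end IsUniversalAction

theorem tensorLeft_symm_whiskerRight {A E X X' M : C} [ExactPairing X X'] (f : E ⟶ X ⊗ A)
    (t : A ⊗ M ⟶ M) :
    (tensorLeftHomEquiv E X X' A).symm f ▷ M ≫ t =
      (α_ _ _ _).hom ≫ (tensorLeftHomEquiv (E ⊗ M) X X' M).symm
        (f ▷ M ≫ (α_ _ _ _).hom ≫ X ◁ t) := by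
  dsimp [tensorLeftHomEquiv]
  calc
    _ = 𝟙 _ ⊗≫ X' ◁ f ▷ M ⊗≫ (ε_ X X' ▷ (A ⊗ M) ≫ 𝟙_ C ◁ t) ⊗≫ 𝟙 _ := by monoidal
    _ = _ := by
      rw [← whisker_exchange]; monoidal

namespace IsUniversalAction

variable {J : ObjectProperty C} {A : C} {θ : ∀ M : C, A ⊗ M ⟶ M} (hA : IsUniversalAction J A θ)
include hA

/-- Duality reduces morphisms into `X ⊗ A` to morphisms from `X' ⊗ E` into `A`, where universality
applies. -/
theorem hom_ext_left {E X X' : C} [ExactPairing X X'] {f g : E ⟶ X ⊗ A}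
    (h : ∀ M, f ▷ M ≫ (α_ _ _ _).hom ≫ X ◁ θ M = g ▷ M ≫ (α_ _ _ _).hom ≫ X ◁ θ M) : f = g := by
  apply (tensorLeftHomEquiv E X X' A).symm.injective
  apply hA.hom_ext
  intro M
  rw [tensorLeft_symm_whiskerRight, tensorLeft_symm_whiskerRight, h]

theorem exists_lift_left {E X X' : C} [ExactPairing X X'] (κ : ∀ M : C, E ⊗ M ⟶ X ⊗ M)
    (natural : ∀ {M N : C} (f : M ⟶ N), E ◁ f ≫ κ N = κ M ≫ X ◁ f)
    (module : ∀ M Y : C, J Y → κ (M ⊗ Y) = (α_ E M Y).inv ≫ κ M ▷ Y ≫ (α_ X M Y).hom) :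
    ∃ f : E ⟶ X ⊗ A, ∀ M, f ▷ M ≫ (α_ _ _ _).hom ≫ X ◁ θ M = κ M := by
  -- The mates of the `κ M` form an action of `X' ⊗ E`; the mate of its classifying morphism is the
  -- lift.
  have hact : IsAction J (X' ⊗ E)
      (fun M => (α_ _ _ _).hom ≫ (tensorLeftHomEquiv (E ⊗ M) X X' M).symm (κ M)) := by
    constructor
    · intro M N f
      dsimp [tensorLeftHomEquiv]
      calc
        _ = 𝟙 _ ⊗≫ X' ◁ (E ◁ f ≫ κ N) ⊗≫ ε_ X X' ▷ N ⊗≫ 𝟙 _ := by monoidal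
        _ = 𝟙 _ ⊗≫ X' ◁ κ M ⊗≫ ((X' ⊗ X) ◁ f ≫ ε_ X X' ▷ N) ⊗≫ 𝟙 _ := by
          rw [natural]; monoidal
        _ = _ := by
          rw [whisker_exchange]; monoidal
    · intro M Y hY
      dsimp [tensorLeftHomEquiv]
      rw [module M Y hY]
      monoidal
  obtain ⟨h, hh, -⟩ := hA.existsUnique _ _ hact
  refine ⟨tensorLeftHomEquiv E X X' A h, fun M => ?_⟩
  have := hh M
  rw [← (tensorLeftHomEquiv E X X' A).symm_apply_apply h, tensorLeft_symm_whiskerRight,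
    Iso.cancel_iso_hom_left] at this
  exact (tensorLeftHomEquiv (E ⊗ M) X X' M).symm.injective this

theorem exists_mul : ∃ m : A ⊗ A ⟶ A, ∀ M, m ▷ M ≫ θ M = (α_ _ _ _).hom ≫ A ◁ θ M ≫ θ M := by
  refine (hA.existsUnique (A ⊗ A) (fun M => (α_ _ _ _).hom ≫ A ◁ θ M ≫ θ M) ⟨?_, ?_⟩).exists
  · intro M N f
    calc
      _ = (α_ _ _ _).hom ≫ A ◁ (A ◁ f ≫ θ N) ≫ θ N := by monoidal
      _ = (α_ _ _ _).hom ≫ A ◁ (θ M ≫ f) ≫ θ N := by rw [hA.isAction.natural f]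
      _ = (α_ _ _ _).hom ≫ A ◁ θ M ≫ A ◁ f ≫ θ N := by monoidal
      _ = _ := by
        rw [hA.isAction.natural f]; monoidal
  · intro M X hX
    rw [hA.isAction.module M X hX]
    monoidal

theorem exists_one : ∃ e : 𝟙_ C ⟶ A, ∀ M, e ▷ M ≫ θ M = (λ_ M).hom := by
  refine (hA.existsUnique (𝟙_ C) (fun M => (λ_ M).hom) ⟨?_, ?_⟩).exists
  · intro M N f
    simp
  · intro M X hX
    monoidal

theorem exists_halfBraiding (X : C) [HasRightDual X] : ∃ s : A ⊗ X ⟶ X ⊗ A,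
    ∀ M, s ▷ M ≫ (α_ _ _ _).hom ≫ X ◁ θ M = (α_ _ _ _).hom ≫ θ (X ⊗ M) := by
  refine hA.exists_lift_left (X' := Xᘁ) _ ?_ ?_
  · intro M N f
    rw [Category.assoc, ← hA.isAction.natural]
    monoidal
  · intro M Y hY
    have h1 := hA.isAction.module (X ⊗ M) Y hY
    have h2 := hA.isAction.natural (α_ X M Y).inv
    calc
      _ = (α_ _ _ _).hom ≫ θ (X ⊗ M ⊗ Y) ≫ (α_ X M Y).inv ≫ (α_ X M Y).hom := by simp
      _ = _ := by
        rw [← reassoc_of% h2, h1]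
        monoidal

/-- The product of a universal action. -/
noncomputable def mul : A ⊗ A ⟶ A := hA.exists_mul.choose

/-- The unit of a universal action. -/
noncomputable def one : 𝟙_ C ⟶ A := hA.exists_one.choose
theorem mul_spec (M : C) : hA.mul ▷ M ≫ θ M = (α_ _ _ _).hom ≫ A ◁ θ M ≫ θ M :=
  hA.exists_mul.choose_spec M

theorem one_spec (M : C) : hA.one ▷ M ≫ θ M = (λ_ M).hom :=
  hA.exists_one.choose_spec M

/-- Both sides act in the same way on every `M`, which suffices by `hom_ext`. The other algebra
axioms follow likewise. -/
theorem one_mul : hA.one ▷ A ≫ hA.mul = (λ_ A).hom := by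
  refine hA.hom_ext fun M => ?_
  calc
    _ = hA.one ▷ A ▷ M ≫ (hA.mul ▷ M ≫ θ M) := by monoidal
    _ = 𝟙 _ ⊗≫ (hA.one ▷ (A ⊗ M) ≫ A ◁ θ M) ≫ θ M := by rw [hA.mul_spec]; monoidal
    _ = 𝟙 _ ⊗≫ θ M ⊗≫ (hA.one ▷ M ≫ θ M) := by rw [← whisker_exchange]; monoidal
    _ = _ := by rw [hA.one_spec]; monoidal

theorem mul_one : A ◁ hA.one ≫ hA.mul = (ρ_ A).hom := by
  refine hA.hom_ext fun M => ?_
  calc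
    _ = (A ◁ hA.one) ▷ M ≫ (hA.mul ▷ M ≫ θ M) := by monoidal
    _ = 𝟙 _ ⊗≫ A ◁ (hA.one ▷ M ≫ θ M) ≫ θ M := by rw [hA.mul_spec]; monoidal
    _ = _ := by rw [hA.one_spec]; monoidal

theorem mul_assoc : hA.mul ▷ A ≫ hA.mul = (α_ A A A).hom ≫ A ◁ hA.mul ≫ hA.mul := by
  refine hA.hom_ext fun M => ?_
  calc
    _ = hA.mul ▷ A ▷ M ≫ (hA.mul ▷ M ≫ θ M) := by monoidal
    _ = 𝟙 _ ⊗≫ (hA.mul ▷ (A ⊗ M) ≫ A ◁ θ M) ≫ θ M := by rw [hA.mul_spec]; monoidal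
    _ = 𝟙 _ ⊗≫ A ◁ A ◁ θ M ⊗≫ (hA.mul ▷ M ≫ θ M) := by rw [← whisker_exchange]; monoidal
    _ = 𝟙 _ ⊗≫ A ◁ ((α_ _ _ _).hom ≫ A ◁ θ M ≫ θ M) ≫ θ M := by rw [hA.mul_spec]; monoidal
    _ = 𝟙 _ ⊗≫ A ◁ (hA.mul ▷ M ≫ θ M) ≫ θ M := by rw [hA.mul_spec]
    _ = 𝟙 _ ⊗≫ (A ◁ hA.mul) ▷ M ≫ ((α_ _ _ _).hom ≫ A ◁ θ M ≫ θ M) := by monoidal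
    _ = _ := by rw [← hA.mul_spec]; monoidal

variable [RigidCategory C]

/-- The half-braiding of a universal action. -/
noncomputable def halfBraidingHom (X : C) : A ⊗ X ⟶ X ⊗ A := (hA.exists_halfBraiding X).choose

theorem halfBraidingHom_spec (X M : C) :
    hA.halfBraidingHom X ▷ M ≫ (α_ _ _ _).hom ≫ X ◁ θ M = (α_ _ _ _).hom ≫ θ (X ⊗ M) :=
  (hA.exists_halfBraiding X).choose_spec M

theorem halfBraidingHom_natural {X Y : C} (f : X ⟶ Y) :
    A ◁ f ≫ hA.halfBraidingHom Y = hA.halfBraidingHom X ≫ f ▷ A := by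
  refine hA.hom_ext_left (X' := Yᘁ) fun M => ?_
  have h1 := hA.halfBraidingHom_spec X M
  have h2 := hA.halfBraidingHom_spec Y M
  calc
    _ = (A ◁ f) ▷ M ≫ (hA.halfBraidingHom Y ▷ M ≫ (α_ _ _ _).hom ≫ Y ◁ θ M) := by monoidal
    _ = (α_ _ _ _).hom ≫ A ◁ (f ▷ M) ≫ θ (Y ⊗ M) := by rw [h2]; monoidal
    _ = (hA.halfBraidingHom X ▷ M ≫ (α_ _ _ _).hom ≫ X ◁ θ M) ≫ f ▷ M := by
      rw [hA.isAction.natural, h1]; monoidal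
    _ = hA.halfBraidingHom X ▷ M ≫ (α_ _ _ _).hom ≫ f ▷ (A ⊗ M) ≫ Y ◁ θ M := by
      rw [← whisker_exchange]; monoidal
    _ = _ := by monoidal

/-- Up to associativity, both sides act on `M` through θ at `X ⊗ Y ⊗ M`. -/
theorem halfBraidingHom_tensor (X Y : C) : hA.halfBraidingHom (X ⊗ Y) =
    (α_ _ _ _).inv ≫ hA.halfBraidingHom X ▷ Y ≫ (α_ _ _ _).hom ≫ X ◁ hA.halfBraidingHom Y ≫
      (α_ _ _ _).inv := by
  refine hA.hom_ext_left (X' := (X ⊗ Y)ᘁ) fun M => ?_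
  rw [hA.halfBraidingHom_spec]
  symm
  calc
    _ = 𝟙 _ ⊗≫ hA.halfBraidingHom X ▷ Y ▷ M ⊗≫
          X ◁ (hA.halfBraidingHom Y ▷ M ≫ (α_ _ _ _).hom ≫ Y ◁ θ M) ⊗≫ 𝟙 _ := by monoidal
    _ = 𝟙 _ ⊗≫ (hA.halfBraidingHom X ▷ (Y ⊗ M) ≫ (α_ _ _ _).hom ≫ X ◁ θ (Y ⊗ M)) ⊗≫ 𝟙 _ := by
      rw [hA.halfBraidingHom_spec]; monoidal
    _ = 𝟙 _ ⊗≫ (θ (X ⊗ Y ⊗ M) ≫ (α_ X Y M).inv) := by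
      rw [hA.halfBraidingHom_spec]; monoidal
    _ = _ := by
      rw [← hA.isAction.natural]; monoidal

theorem halfBraidingHom_unit : hA.halfBraidingHom (𝟙_ C) = (ρ_ A).hom ≫ (λ_ A).inv := by
  refine hA.hom_ext_left (X' := (𝟙_ C)ᘁ) fun M => ?_
  rw [hA.halfBraidingHom_spec]
  have h := hA.isAction.natural (λ_ M).hom
  calc
    _ = (α_ _ _ _).hom ≫ (θ (𝟙_ C ⊗ M) ≫ (λ_ M).hom) ≫ (λ_ M).inv := by simp
    _ = _ := by
      rw [← h]; monoidal

instance (X : C) : IsIso (hA.halfBraidingHom X) :=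
  isIso_laxHalfBraiding _ hA.halfBraidingHom_natural hA.halfBraidingHom_tensor
    hA.halfBraidingHom_unit (ᘁX) X

/-- The object of the center given by a universal action. -/
noncomputable def center : Center C :=
  ⟨A, { β := fun X => asIso (hA.halfBraidingHom X)
        monoidal := hA.halfBraidingHom_tensor
        naturality := hA.halfBraidingHom_natural }⟩

/-- Up to associativity, both sides let `A` act twice on `X ⊗ M`. -/
theorem mul_comm_halfBraiding (X : C) :
    hA.mul ▷ X ≫ hA.halfBraidingHom X =
      ((α_ _ _ _).hom ≫ A ◁ hA.halfBraidingHom X ≫ (α_ _ _ _).inv ≫ hA.halfBraidingHom X ▷ A ≫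
        (α_ _ _ _).hom) ≫ X ◁ hA.mul := by
  refine hA.hom_ext_left (X' := Xᘁ) fun M => ?_
  symm
  calc
    _ = 𝟙 _ ⊗≫ A ◁ hA.halfBraidingHom X ▷ M ⊗≫ hA.halfBraidingHom X ▷ A ▷ M ⊗≫
          X ◁ (hA.mul ▷ M ≫ θ M) := by monoidal
    _ = 𝟙 _ ⊗≫ A ◁ hA.halfBraidingHom X ▷ M ⊗≫
          (hA.halfBraidingHom X ▷ (A ⊗ M) ≫ (X ⊗ A) ◁ θ M) ⊗≫ X ◁ θ M := by
      rw [hA.mul_spec]; monoidal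
    _ = 𝟙 _ ⊗≫ A ◁ (hA.halfBraidingHom X ▷ M ≫ (α_ _ _ _).hom ≫ X ◁ θ M) ⊗≫
          (hA.halfBraidingHom X ▷ M ≫ (α_ _ _ _).hom ≫ X ◁ θ M) := by
      rw [← whisker_exchange]; monoidal
    _ = 𝟙 _ ⊗≫ ((α_ _ _ _).hom ≫ A ◁ θ (X ⊗ M) ≫ θ (X ⊗ M)) := by
      rw [hA.halfBraidingHom_spec]; monoidal
    _ = (hA.mul ▷ X) ▷ M ≫ ((α_ _ _ _).hom ≫ θ (X ⊗ M)) := by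
      rw [← hA.mul_spec]; monoidal
    _ = _ := by
      rw [← hA.halfBraidingHom_spec]; monoidal

theorem one_comm_halfBraiding (X : C) :
    hA.one ▷ X ≫ hA.halfBraidingHom X = ((λ_ X).hom ≫ (ρ_ X).inv) ≫ X ◁ hA.one := by
  refine hA.hom_ext_left (X' := Xᘁ) fun M => ?_
  symm
  calc
    _ = 𝟙 _ ⊗≫ X ◁ (hA.one ▷ M ≫ θ M) := by monoidal
    _ = 𝟙 _ ⊗≫ (λ_ (X ⊗ M)).hom := by rw [hA.one_spec]; monoidal
    _ = (hA.one ▷ X) ▷ M ≫ ((α_ _ _ _).hom ≫ θ (X ⊗ M)) := by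
      rw [← hA.one_spec]; monoidal
    _ = _ := by
      rw [← hA.halfBraidingHom_spec]; monoidal

/-- The algebra in the center given by a universal action. -/
noncomputable def alg : Mon (Center C) where
  X := hA.center
  mon :=
    { one := ⟨hA.one, hA.one_comm_halfBraiding⟩
      mul := ⟨hA.mul, fun X => hA.mul_comm_halfBraiding X⟩
      one_mul := by ext; exact hA.one_mul
      mul_one := by ext; exact hA.mul_one
      mul_assoc := by ext; exact hA.mul_assoc }

end IsUniversalAction

end Action

/-! ### Transposition between wedges and actions -/

section Translation

variable {C : Type u} [Category.{v} C] [MonoidalCategory C] [RightRigidCategory C]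

theorem whiskerRight_ihomEv {E M N : C} (π : E ⟶ ihomObj M N) :
    π ▷ M ≫ ihomEv M N = (ψ E M N).symm π := by
  rw [ihomEv, ← tensorRightHomEquiv_symm_naturality, Category.comp_id]

theorem ψ_symm_comp_whiskerRight {E M N N' : C} (π : E ⟶ ihomObj M N) (f : N ⟶ N') :
    (ψ E M N').symm (π ≫ f ▷ Mᘁ) = (ψ E M N).symm π ≫ f := by
  rw [Equiv.symm_apply_eq, tensorRightHomEquiv_naturality, Equiv.apply_symm_apply]

theorem ψ_symm_comp_whiskerLeft {E M M' N : C} (π : E ⟶ ihomObj M' N) (f : M ⟶ M') :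
    (ψ E M N).symm (π ≫ N ◁ (fᘁ)) = E ◁ f ≫ (ψ E M' N).symm π := by
  dsimp [ψ, tensorRightHomEquiv]
  calc
    _ = π ▷ M ⊗≫ N ◁ ((fᘁ) ▷ M ≫ ε_ M (Mᘁ)) ⊗≫ 𝟙 _ := by monoidal
    _ = (π ▷ M ≫ (N ⊗ M'ᘁ) ◁ f) ⊗≫ N ◁ ε_ M' (M'ᘁ) ⊗≫ 𝟙 _ := by
      rw [rightAdjointMate_comp_evaluation]; monoidal
    _ = _ := by
      rw [← whisker_exchange]; monoidal

theorem isDinatural_iff {E : C} (π : ∀ M : C, E ⟶ ihomObj M M) :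
    IsDinatural (ihomFunctor C) E π ↔
      ∀ {M N : C} (f : M ⟶ N), E ◁ f ≫ (ψ E N N).symm (π N) = (ψ E M M).symm (π M) ≫ f := by
  refine forall_congr' fun M => forall_congr' fun N => forall_congr' fun f => ?_
  dsimp only [ihomFunctor]
  rw [← (ψ E M N).symm.injective.eq_iff, ← ψ_symm_comp_whiskerLeft, ← ψ_symm_comp_whiskerRight,
    eq_comm]
  rfl

theorem isAction_bot_iff {E : C} (π : ∀ M : C, E ⟶ ihomObj M M) :
    IsAction ⊥ E (fun M => (ψ E M M).symm (π M)) ↔ IsDinatural (ihomFunctor C) E π := by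
  rw [isDinatural_iff]
  exact ⟨fun h => h.natural, fun h => ⟨h, fun _ _ hX => hX.elim⟩⟩

theorem ihomB_eq (X M N : C) :
    ihomB X M N = ψ (ihomObj (X ⊗ M) N ⊗ X) M N ((α_ _ _ _).hom ≫ ihomEv (X ⊗ M) N) :=
  (tensorRightHomEquiv _ X (Xᘁ) _).symm_apply_apply _

theorem halfBraiding_iff {A X M : C} (s : A ⊗ X ⟶ X ⊗ A) (π : ∀ M : C, A ⟶ ihomObj M M) :
    s ≫ X ◁ π M = π (X ⊗ M) ▷ X ≫ ihomB X M (X ⊗ M) ≫ ihomA X M M ↔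
      s ▷ M ≫ (α_ _ _ _).hom ≫ X ◁ (ψ A M M).symm (π M) =
        (α_ _ _ _).hom ≫ (ψ A (X ⊗ M) (X ⊗ M)).symm (π (X ⊗ M)) := by
  have h1 : (ψ _ M (X ⊗ M)).symm (s ≫ X ◁ π M ≫ (α_ X M (Mᘁ)).inv) =
      s ▷ M ≫ (α_ _ _ _).hom ≫ X ◁ (ψ A M M).symm (π M) := by
    dsimp [ψ, tensorRightHomEquiv]
    monoidal
  have h2 : (ψ _ M (X ⊗ M)).symm (π (X ⊗ M) ▷ X ≫ ihomB X M (X ⊗ M)) =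
      (α_ _ _ _).hom ≫ (ψ A (X ⊗ M) (X ⊗ M)).symm (π (X ⊗ M)) := by
    rw [tensorRightHomEquiv_symm_naturality, ihomB_eq, Equiv.symm_apply_apply,
      ← whiskerRight_ihomEv]
    simp
  rw [← h1, ← h2, (ψ _ M (X ⊗ M)).symm.injective.eq_iff, ← Category.assoc s, Iso.comp_inv_eq,
    Category.assoc]
  rfl

theorem mul_iff {A M : C} (m : A ⊗ A ⟶ A) (π : A ⟶ ihomObj M M) :
    m ≫ π = (π ⊗ₘ π) ≫ ihomComp M ↔
      m ▷ M ≫ (ψ A M M).symm π = (α_ _ _ _).hom ≫ A ◁ (ψ A M M).symm π ≫ (ψ A M M).symm π := by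
  rw [← (ψ _ M M).symm.injective.eq_iff, tensorRightHomEquiv_symm_naturality,
    tensorRightHomEquiv_symm_naturality, ihomComp, Equiv.symm_apply_apply]
  refine Eq.congr rfl ?_
  rw [← whiskerRight_ihomEv, MonoidalCategory.tensorHom_def]
  calc
    _ = 𝟙 _ ⊗≫ (π ▷ (A ⊗ M) ≫ _ ◁ (π ▷ M ≫ ihomEv M M)) ≫ ihomEv M M := by monoidal
    _ = _ := by
      rw [← whisker_exchange]; monoidal

theorem one_iff {A M : C} (e : 𝟙_ C ⟶ A) (π : A ⟶ ihomObj M M) :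
    e ≫ π = ihomCoev M ↔ e ▷ M ≫ (ψ A M M).symm π = (λ_ M).hom := by
  rw [← (ψ _ M M).symm.injective.eq_iff, tensorRightHomEquiv_symm_naturality, ihomCoev,
    Equiv.symm_apply_apply]

theorem comp_ψ_iff {E A M : C} (h : E ⟶ A) (π : A ⟶ ihomObj M M) (π' : E ⟶ ihomObj M M) :
    h ≫ π = π' ↔ h ▷ M ≫ (ψ A M M).symm π = (ψ E M M).symm π' := by
  rw [← (ψ _ M M).symm.injective.eq_iff, tensorRightHomEquiv_symm_naturality]

/-- Joint monicity of the wedge survives tensoring on the left with a dualizable object, by passing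
to mates. -/
theorem hom_ext_whiskerLeft {A : C} {π : ∀ M : C, A ⟶ ihomObj M M}
    (hext : ∀ (E : C) {f g : E ⟶ A}, (∀ M, f ≫ π M = g ≫ π M) → f = g)
    {E X X' : C} [ExactPairing X X'] {f g : E ⟶ X ⊗ A} (h : ∀ M, f ≫ X ◁ π M = g ≫ X ◁ π M) :
    f = g := by
  apply (tensorLeftHomEquiv E X X' A).symm.injective
  refine hext _ fun M => ?_
  apply (tensorLeftHomEquiv E X X' (ihomObj M M)).injective
  rw [tensorLeftHomEquiv_naturality, tensorLeftHomEquiv_naturality, Equiv.apply_symm_apply,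
    Equiv.apply_symm_apply, h]

theorem isUniversalAction_of_universal {J : ObjectProperty C} {A : C} {π : ∀ M : C, A ⟶ ihomObj M M}
    {good : ∀ E : C, (∀ M : C, E ⟶ ihomObj M M) → Prop}
    (hgood : ∀ (E : C) (π : ∀ M : C, E ⟶ ihomObj M M),
      IsAction J E (fun M => (ψ E M M).symm (π M)) ↔ good E π)
    (hA : good A π)
    (univ : ∀ (E : C) (π' : ∀ M : C, E ⟶ ihomObj M M), good E π' →
      ∃! h : E ⟶ A, ∀ M : C, h ≫ π M = π' M) :
    IsUniversalAction J A (fun M => (ψ A M M).symm (π M)) where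
  isAction := (hgood A π).2 hA
  existsUnique E θ hθ := by
    have := univ E (fun M => ψ E M M (θ M)) ((hgood _ _).1 (by simpa using hθ))
    simpa only [comp_ψ_iff, Equiv.symm_apply_apply] using this

theorem IsEnd.isUniversalAction {A : C} {π : ∀ M : C, A ⟶ ihomObj M M}
    (h : IsEnd (ihomFunctor C) A π) :
    IsUniversalAction ⊥ A (fun M => (ψ A M M).symm (π M)) :=
  isUniversalAction_of_universal (fun _ => isAction_bot_iff) h.dinatural h.existsUnique

end Translation

/-! ### Algebra morphisms and compatibility with the prebalancing -/

section Compatible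

variable {C : Type u} [Category.{v} C] [MonoidalCategory C] [RigidCategory C]

theorem IsUniversalAction.isDeterminedBy {J : ObjectProperty C} {A : C}
    {π : ∀ M : C, A ⟶ ihomObj M M}
    (hA : IsUniversalAction J A (fun M => (ψ A M M).symm (π M))) :
    IsDeterminedBy hA.alg π where
  halfBraiding X _ := (halfBraiding_iff (hA.halfBraidingHom X) π).2 (hA.halfBraidingHom_spec X _)
  mul M := (mul_iff hA.mul (π M)).2 (hA.mul_spec M)
  one M := (one_iff hA.one (π M)).2 (hA.one_spec M)

/-- The morphism from an algebra with a compatible action to an algebra determined by a universal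
action is a morphism of algebras in the center. -/
theorem IsUniversalAction.exists_algHom {J : ObjectProperty C} {A B : Mon (Center C)}
    {α : ∀ M : C, B.X.1 ⟶ ihomObj M M} {π : ∀ M : C, A.X.1 ⟶ ihomObj M M}
    (hB : IsDeterminedBy B α) (hA : IsDeterminedBy A π)
    (univ : IsUniversalAction J A.X.1 (fun M => (ψ A.X.1 M M).symm (π M)))
    (hact : IsAction J B.X.1 (fun M => (ψ B.X.1 M M).symm (α M))) :
    ∃ i : B ⟶ A, ∀ M : C, i.hom.f ≫ π M = α M := by
  obtain ⟨h, hh, -⟩ := univ.existsUnique _ _ hact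
  have hext : ∀ {E : C} {f g : E ⟶ A.X.1}, (∀ M, f ≫ π M = g ≫ π M) → f = g := fun H =>
    univ.hom_ext fun M => by
      rw [← tensorRightHomEquiv_symm_naturality, ← tensorRightHomEquiv_symm_naturality, H]
  have hπ : ∀ M, h ≫ π M = α M := fun M => (comp_ψ_iff _ _ _).2 (hh M)
  have hcomm : ∀ X, h ▷ X ≫ (A.X.2.β X).hom = (B.X.2.β X).hom ≫ X ◁ h := by
    intro X
    refine hom_ext_whiskerLeft (X' := Xᘁ) (fun _ => hext) fun M => ?_
    rw [Category.assoc, hA.halfBraiding, Category.assoc, ← whiskerLeft_comp, hπ, hB.halfBraiding,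
      ← comp_whiskerRight_assoc, hπ]
  refine ⟨{ hom := Center.Hom.mk h hcomm, isMonHom_hom := ⟨?_, ?_⟩ }, hπ⟩
  · ext
    refine hext fun M => ?_
    change ((η[B.X]).f ≫ h) ≫ π M = (η[A.X]).f ≫ π M
    rw [Category.assoc, hπ, hA.one, hB.one]
  · ext
    refine hext fun M => ?_
    change ((μ[B.X]).f ≫ h) ≫ π M = ((h ⊗ₘ h) ≫ (μ[A.X]).f) ≫ π M
    refine (Category.assoc _ _ _).trans (Eq.trans ?_ (Category.assoc _ _ _).symm)
    refine Eq.trans ?_ (congrArg ((h ⊗ₘ h) ≫ ·) (hA.mul M)).symm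
    rw [hπ, tensorHom_comp_tensorHom_assoc, hπ]
    exact hB.mul M

theorem dualIso_inv_comp_evaluation (M X : C) :
    (dualIso M X).inv ▷ (M ⊗ (ᘁX : C)) ≫ ε_ (M ⊗ (ᘁX : C)) ((M ⊗ (ᘁX : C))ᘁ) =
      𝟙 _ ⊗≫ X ◁ (ε_ M (Mᘁ) ▷ (ᘁX : C)) ⊗≫ ε_ (ᘁX : C) X := by
  rw [← ExactPairing.tensor_evaluation]
  -- The inverse of `dualIso` is the mate of the identity for two choices of dual of the same
  -- object.
  have := @rightAdjointMate_comp_evaluation _ _ _ (M ⊗ (ᘁX : C)) (M ⊗ (ᘁX : C)) _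
    (@HasRightDual.mk _ _ _ _ (X ⊗ Mᘁ) ExactPairing.tensor) (𝟙 _)
  refine this.trans ?_
  erw [whiskerLeft_id, Category.id_comp]
  rfl

theorem ψ_symm_comp_dualIso {E M N X : C} (π : E ⟶ ihomObj N (M ⊗ X)) :
    (ψ E (N ⊗ (ᘁX : C)) M).symm (π ≫ (α_ M X (Nᘁ)).hom ≫ M ◁ (dualIso N X).inv) =
      (α_ _ _ _).inv ≫ (ψ E N (M ⊗ X)).symm π ▷ (ᘁX : C) ≫ (α_ _ _ _).hom ≫
        M ◁ ε_ (ᘁX : C) X ≫ (ρ_ M).hom := by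
  dsimp [ψ, tensorRightHomEquiv]
  calc
    _ = π ▷ (N ⊗ (ᘁX : C)) ⊗≫ M ◁ ((dualIso N X).inv ▷ (N ⊗ (ᘁX : C)) ≫ ε_ _ _) ⊗≫ 𝟙 _ := by
      monoidal
    _ = _ := by
      rw [dualIso_inv_comp_evaluation]; monoidal

/-- The two equations correspond under bending the strand `X` with its left dual, which loses
nothing by the zigzag identities. -/
theorem compatible_iff {E M X : C} (θ : E ⊗ M ⟶ M) (κ : E ⊗ (M ⊗ X) ⟶ M ⊗ X) :
    E ◁ (M ◁ ε_ (ᘁX : C) X ≫ (ρ_ M).hom) ≫ θ =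
        E ◁ (α_ M X (ᘁX : C)).inv ≫ (α_ _ _ _).inv ≫ κ ▷ (ᘁX : C) ≫ (α_ _ _ _).hom ≫
          M ◁ ε_ (ᘁX : C) X ≫ (ρ_ M).hom ↔
      κ = (α_ E M X).inv ≫ θ ▷ X := by
  constructor
  · intro h
    calc
      κ = 𝟙 _ ⊗≫ κ ⊗≫ M ◁ (X ◁ η_ (ᘁX : C) X ⊗≫ ε_ (ᘁX : C) X ▷ X) ⊗≫ 𝟙 _ := by
        rw [ExactPairing.coevaluation_evaluation'']; monoidal
      _ = 𝟙 _ ⊗≫ (κ ▷ 𝟙_ C ≫ (M ⊗ X) ◁ η_ (ᘁX : C) X) ⊗≫ (M ◁ ε_ (ᘁX : C) X) ▷ X ⊗≫ 𝟙 _ := by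
        monoidal
      _ = 𝟙 _ ⊗≫ E ◁ M ◁ X ◁ η_ (ᘁX : C) X ⊗≫
          (E ◁ (α_ M X (ᘁX : C)).inv ≫ (α_ _ _ _).inv ≫ κ ▷ (ᘁX : C) ≫ (α_ _ _ _).hom ≫
          M ◁ ε_ (ᘁX : C) X ≫ (ρ_ M).hom) ▷ X ⊗≫ 𝟙 _ := by
        rw [← whisker_exchange]; monoidal
      _ = 𝟙 _ ⊗≫ E ◁ M ◁ (X ◁ η_ (ᘁX : C) X ⊗≫ ε_ (ᘁX : C) X ▷ X) ⊗≫ θ ▷ X ⊗≫ 𝟙 _ := by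
        rw [← h]; monoidal
      _ = _ := by
        rw [ExactPairing.coevaluation_evaluation'']; monoidal
  · rintro rfl
    calc
      _ = 𝟙 _ ⊗≫ ((E ⊗ M) ◁ ε_ (ᘁX : C) X ≫ θ ▷ 𝟙_ C) ⊗≫ 𝟙 _ := by monoidal
      _ = _ := by
        rw [whisker_exchange]; monoidal

theorem isCompatible_iff (D : ObjectProperty C) [IsTensorSubcategory D] {E : C}
    (π : ∀ M : C, E ⟶ ihomObj M M) :
    (revPrebalancing D).IsCompatible E π ↔
      ∀ M X : C, D X → (ψ E (M ⊗ X) (M ⊗ X)).symm (π (M ⊗ X)) =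
        (α_ E M X).inv ≫ (ψ E M M).symm (π M) ▷ X := by
  have key : ∀ M X : C,
      π M ≫ M ◁ ((M ◁ ε_ (ᘁX : C) X ≫ (ρ_ M).hom)ᘁ) =
        π (M ⊗ X) ≫ ((α_ M X _).hom ≫ M ◁ (dualIso (M ⊗ X) X).inv) ≫
          M ◁ ((α_ M X (ᘁX : C)).invᘁ) ↔
      (ψ E (M ⊗ X) (M ⊗ X)).symm (π (M ⊗ X)) = (α_ E M X).inv ≫ (ψ E M M).symm (π M) ▷ X := by
    intro M X
    rw [← compatible_iff, ← ψ_symm_comp_dualIso, ← ψ_symm_comp_whiskerLeft,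
      ← ψ_symm_comp_whiskerLeft, (ψ _ _ _).symm.injective.eq_iff]
    simp only [Category.assoc]
  constructor
  · intro h M X hX
    exact (key M X).1 (h (mop ⟨X, hX⟩) M)
  · intro h X M
    exact (key M (unmop X).obj).2 (h M _ (unmop X).property)

theorem isAction_iff (D : ObjectProperty C) [IsTensorSubcategory D] {E : C}
    (π : ∀ M : C, E ⟶ ihomObj M M) :
    IsAction D E (fun M => (ψ E M M).symm (π M)) ↔
      IsDinatural (ihomFunctor C) E π ∧ (revPrebalancing D).IsCompatible E π := by
  rw [isDinatural_iff, isCompatible_iff]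
  exact ⟨fun h => ⟨h.natural, h.module⟩, fun h => ⟨h.1, h.2⟩⟩

theorem isUniversalAction_of_isRelativeEnd (D : ObjectProperty C) [IsTensorSubcategory D] {A : C}
    {π : ∀ M : C, A ⟶ ihomObj M M} (h : (revPrebalancing D).IsRelativeEnd A π) :
    IsUniversalAction D A (fun M => (ψ A M M).symm (π M)) :=
  isUniversalAction_of_universal (fun _ => isAction_iff D) ⟨h.dinatural, h.compatible⟩
    fun E π' h' => h.existsUnique E π' h'.1 h'.2

end Compatible

/-! ### Existence of ends and relative ends -/

section Existence

variable {C : Type u} [Category.{v} C] [Abelian C] [MonoidalCategory C] [MonoidalPreadditive C]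
  [RigidCategory C]

/-- By rigidity `g` is a morphism from `Y` to `ᘁE ⊗ Y`, and composing with the dual of `f` becomes
precomposing with `f`. -/
theorem SeparatesFrom.eq_zero {P E Y : C} (hP : SeparatesFrom P Y) (g : E ⟶ ihomObj Y Y)
    (h : ∀ f : P ⟶ Y, g ≫ Y ◁ (fᘁ) = 0) : g = 0 := by
  have hr : tensorLeftHomEquiv Y (ᘁE : C) E Y ((ψ E Y Y).symm g) = 0 := by
    refine hP _ fun f => ?_
    have h1 : E ◁ f ≫ (ψ E Y Y).symm g = 0 := by
      rw [← ψ_symm_comp_whiskerLeft, h f]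
      simp [tensorRightHomEquiv]
    apply (tensorLeftHomEquiv P (ᘁE : C) E Y).symm.injective
    rw [tensorLeftHomEquiv_symm_naturality, Equiv.symm_apply_apply, h1]
    simp [tensorLeftHomEquiv]
  rw [← (ψ E Y Y).apply_symm_apply g,
    ← (tensorLeftHomEquiv Y (ᘁE : C) E Y).symm_apply_apply ((ψ E Y Y).symm g), hr]
  simp [tensorLeftHomEquiv, tensorRightHomEquiv]

theorem exists_isEnd [∀ X : C, IsNoetherianObject X] {P : C} (hP : ∀ Y : C, SeparatesFrom P Y) :
    ∃ (A : C) (π : ∀ M : C, A ⟶ ihomObj M M), IsEnd (ihomFunctor C) A π := by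
  obtain ⟨A, π, hmono, hπ, huniv⟩ := exists_universal_family (R := Σ M N : C, M ⟶ N)
    (fun M : C => ihomObj M M) (s := fun r => r.1) (t := fun r => r.2.1)
    (W := fun r => ihomObj r.1 r.2.1)
    (fun r => r.2.2 ▷ r.1ᘁ) (fun r => r.2.1 ◁ (r.2.2ᘁ)) P
    (fun E π hπ h0 Y => (hP Y).eq_zero _ fun f => by
      rw [← hπ ⟨P, Y, f⟩, h0, zero_comp])
  refine ⟨A, π, fun M N f => hπ ⟨M, N, f⟩, fun E π' h' => ?_⟩
  obtain ⟨h, hh⟩ := huniv E π' fun r => h' r.2.2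
  exact ⟨h, hh, fun k hk => (cancel_mono (π P)).1 ((hk P).trans (hh P).symm)⟩

theorem exists_isRelativeEnd [∀ X : C, IsNoetherianObject X] {P : C}
    (hP : ∀ Y : C, SeparatesFrom P Y) (D : ObjectProperty C) [IsTensorSubcategory D] :
    ∃ (A : C) (π : ∀ M : C, A ⟶ ihomObj M M), (revPrebalancing D).IsRelativeEnd A π := by
  -- The left summand indexes the dinaturality equations, the right one the compatibility equations;
  -- detection at `P` needs only the former.
  let s : (Σ M N : C, M ⟶ N) ⊕ (D.FullSubcategoryᴹᵒᵖ × C) → C :=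
    Sum.elim (fun r => r.1) (fun r => r.2)
  let t : (Σ M N : C, M ⟶ N) ⊕ (D.FullSubcategoryᴹᵒᵖ × C) → C :=
    Sum.elim (fun r => r.2.1) (fun r => r.1 ⊙ₗ r.2)
  let W : (Σ M N : C, M ⟶ N) ⊕ (D.FullSubcategoryᴹᵒᵖ × C) → C :=
    Sum.elim (fun r => ihomObj r.1 r.2.1)
      (fun r => ihomObj (((r.1ᘁ : D.FullSubcategoryᴹᵒᵖ) ⊗ r.1) ⊙ₗ r.2) r.2)
  let a : ∀ r, ihomObj (s r) (s r) ⟶ W r := Sum.rec (fun r => r.2.2 ▷ r.1ᘁ)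
    (fun r => ((ihomFunctor C).map
      ((ε_ r.1 (r.1ᘁ : D.FullSubcategoryᴹᵒᵖ) ⊵ₗ r.2) ≫ (λₗ r.2).hom).op).app r.2)
  let b : ∀ r, ihomObj (t r) (t r) ⟶ W r := Sum.rec (fun r => r.2.1 ◁ (r.2.2ᘁ))
    (fun r => ((revPrebalancing D).iso r.1 (r.1 ⊙ₗ r.2) r.2).hom ≫
      ((ihomFunctor C).map (αₗ (r.1ᘁ : D.FullSubcategoryᴹᵒᵖ) r.1 r.2).hom.op).app r.2)
  obtain ⟨A, π, hmono, hπ, huniv⟩ := exists_universal_family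
    (fun M : C => ihomObj M M) (s := s) (t := t) (W := W) a b P
    (fun E π hπ h0 Y => (hP Y).eq_zero _ fun f => by
      refine (hπ (Sum.inl ⟨P, Y, f⟩)).symm.trans ?_
      change π P ≫ f ▷ Pᘁ = 0
      rw [h0, zero_comp])
  refine ⟨A, π, fun M N f => hπ (Sum.inl ⟨M, N, f⟩), fun X M => hπ (Sum.inr ⟨X, M⟩),
    fun E π' h1 h2 => ?_⟩
  obtain ⟨h, hh⟩ := huniv E π' (Sum.rec (fun r => h1 r.2.2) (fun r => h2 r.1 r.2))
  exact ⟨h, hh, fun k hk => (cancel_mono (π P)).1 ((hk P).trans (hh P).symm)⟩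

/-- The end of `Y ⊗ Y*` over the objects of a tensor subcategory `D` is an end in the ambient
category. -/
theorem exists_isEnd_fullSubcategory (D : ObjectProperty C) [IsTensorSubcategory D]
    [∀ X : C, IsNoetherianObject X] {P : C} (hDP : D P) (hP : ∀ Y : C, D Y → SeparatesFrom P Y) :
    ∃ (A : D.FullSubcategory) (π : ∀ Y : D.FullSubcategory, A ⟶ ihomObj Y Y),
      IsEnd (ihomFunctor D.FullSubcategory) A π ∧
      (∀ (E : C) (f g : E ⟶ A.obj), (∀ Y, f ≫ (π Y).hom = g ≫ (π Y).hom) → f = g) ∧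
      ∀ (E : C) (π' : ∀ Y : D.FullSubcategory, E ⟶ ihomObj Y.obj Y.obj),
        (∀ ⦃Y Z : D.FullSubcategory⦄ (f : Y ⟶ Z),
          π' Y ≫ f.hom ▷ (Y.objᘁ) = π' Z ≫ Z.obj ◁ (f.homᘁ)) →
        ∃ h : E ⟶ A.obj, ∀ Y, h ≫ (π Y).hom = π' Y := by
  let P' : D.FullSubcategory := ⟨P, hDP⟩
  obtain ⟨A, π, hmono, hπ, huniv⟩ := exists_universal_family
    (R := Σ Y Z : D.FullSubcategory, Y ⟶ Z)
    (fun Y : D.FullSubcategory => ihomObj Y.obj Y.obj) (s := fun r => r.1) (t := fun r => r.2.1)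
    (W := fun r => ihomObj r.1.obj r.2.1.obj)
    (fun r => r.2.2.hom ▷ (r.1.objᘁ)) (fun r => r.2.1.obj ◁ (r.2.2.homᘁ)) P'
    (fun E π hπ h0 Y => (hP Y.obj Y.property).eq_zero _ fun f => by
      refine (hπ ⟨P', Y, ObjectProperty.homMk f⟩).symm.trans ?_
      rw [h0, zero_comp])
  -- The universal object, built in `C`, is a subobject of an object of `D`.
  have hDA : D A := D.prop_of_mono (π P') (ihomObj P' P').property
  refine ⟨⟨A, hDA⟩, fun Y => ObjectProperty.homMk (π Y), ⟨fun Y Z f => ?_, fun E π' h' => ?_⟩,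
    fun E f g hfg => ?_, fun E π' h' => ?_⟩
  · ext
    exact hπ ⟨Y, Z, f⟩
  · obtain ⟨h, hh⟩ := huniv E.obj (fun Y => (π' Y).hom) fun r =>
      congrArg (fun k => k.hom) (h' r.2.2)
    refine ⟨ObjectProperty.homMk h, fun Y => ?_, fun k hk => ?_⟩
    · ext
      exact hh Y
    · ext
      rw [← cancel_mono (π P')]
      exact (congrArg (fun k => k.hom) (hk P')).trans (hh P').symm
  · rw [← cancel_mono (π P')]
    exact hfg P'
  · exact huniv E π' fun r => h' r.2.2

/-- An end of `Y ⊗ Y*` in a tensor subcategory is an end in the ambient category. -/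
theorem IsEnd.ambient (D : ObjectProperty C) [IsTensorSubcategory D]
    [∀ X : C, IsNoetherianObject X] {P : C} (hDP : D P) (hP : ∀ Y : C, D Y → SeparatesFrom P Y)
    {A : D.FullSubcategory} {π : ∀ Y : D.FullSubcategory, A ⟶ ihomObj Y Y}
    (hA : IsEnd (ihomFunctor D.FullSubcategory) A π) :
    (∀ (E : C) (f g : E ⟶ A.obj), (∀ Y, f ≫ (π Y).hom = g ≫ (π Y).hom) → f = g) ∧
      ∀ (E : C) (π' : ∀ Y : D.FullSubcategory, E ⟶ ihomObj Y.obj Y.obj),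
        (∀ ⦃Y Z : D.FullSubcategory⦄ (f : Y ⟶ Z),
          π' Y ≫ f.hom ▷ (Y.objᘁ) = π' Z ≫ Z.obj ◁ (f.homᘁ)) →
        ∃ h : E ⟶ A.obj, ∀ Y, h ≫ (π Y).hom = π' Y := by
  obtain ⟨B, ϖ, hB, hext, huniv⟩ := exists_isEnd_fullSubcategory D hDP hP
  obtain ⟨i, hi, -⟩ := hA.existsUnique B ϖ hB.dinatural
  obtain ⟨j, hj, -⟩ := hB.existsUnique A π hA.dinatural
  have hji : j ≫ i = 𝟙 A := (hA.existsUnique A π hA.dinatural).unique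
    (fun Y => (Category.assoc _ _ _).trans ((congrArg (j ≫ ·) (hi Y)).trans (hj Y)))
    (fun Y => Category.id_comp _)
  have hi' : ∀ Y, i.hom ≫ (π Y).hom = (ϖ Y).hom := fun Y => congrArg (fun k => k.hom) (hi Y)
  have hj' : ∀ Y, j.hom ≫ (ϖ Y).hom = (π Y).hom := fun Y => congrArg (fun k => k.hom) (hj Y)
  have hji' : j.hom ≫ i.hom = 𝟙 A.obj := congrArg (fun k => k.hom) hji
  refine ⟨fun E f g hfg => ?_, fun E π' h' => ?_⟩
  · have : f ≫ j.hom = g ≫ j.hom := hext _ _ _ fun Y => by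
      rw [Category.assoc, Category.assoc, hj', hfg]
    rw [← Category.comp_id f, ← hji', reassoc_of% this, hji', Category.comp_id]
  · obtain ⟨h, hh⟩ := huniv E π' h'
    exact ⟨h ≫ i.hom, fun Y => by rw [Category.assoc, hi', hh]⟩

end Existence

/-! ### Algebras of the subcategory viewed in the ambient category -/

section Ambient

variable {C : Type u} [Category.{v} C] [MonoidalCategory C]

theorem one_underlying (A : Mon (Center C)) : η[(underlying A).X] = (η[A.X]).f :=
  Category.id_comp _

theorem mul_underlying (A : Mon (Center C)) : μ[(underlying A).X] = (μ[A.X]).f :=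
  Category.id_comp _

variable [RigidCategory C]

/-- The components of a compatible wedge at the objects of `D` factor through the component at the
unit object. -/
theorem comp_ihomCoev_eq {D : ObjectProperty C} {E : C} {π : ∀ M : C, E ⟶ ihomObj M M}
    (h : IsAction D E (fun M => (ψ E M M).symm (π M))) (Y : C) (hY : D Y) :
    (π (𝟙_ C) ≫ (ρ_ _).inv ≫ ihomEv (𝟙_ C) (𝟙_ C)) ≫ ihomCoev Y = π Y := by
  have h1 : π (𝟙_ C) ≫ (ρ_ _).inv ≫ ihomEv (𝟙_ C) (𝟙_ C) =
      (ρ_ E).inv ≫ (ψ E (𝟙_ C) (𝟙_ C)).symm (π (𝟙_ C)) := by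
    rw [← whiskerRight_ihomEv, ← rightUnitor_inv_naturality_assoc]
  rw [h1]
  apply (ψ E Y Y).symm.injective
  rw [tensorRightHomEquiv_symm_naturality, ihomCoev, Equiv.symm_apply_apply]
  -- The action on `Y` is the one on `𝟙_ C ⊗ Y` transported by the unitor, hence the action on `𝟙_
  -- C` tensored with `Y`.
  have h2 := h.module (𝟙_ C) Y hY
  have h3 := h.natural (λ_ Y).hom
  have h4 : (ψ E Y Y).symm (π Y) = E ◁ (λ_ Y).inv ≫
      (ψ E (𝟙_ C ⊗ Y) (𝟙_ C ⊗ Y)).symm (π (𝟙_ C ⊗ Y)) ≫ (λ_ Y).hom := by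
    rw [← h3, ← whiskerLeft_comp_assoc, Iso.inv_hom_id, whiskerLeft_id, Category.id_comp]
  rw [h4, h2]
  monoidal

variable (D : ObjectProperty C) [IsTensorSubcategory D]

theorem one_ambient (A : Mon (Center D.FullSubcategory)) :
    η[(ambient D (underlying A)).X] = (η[A.X]).f.hom :=
  (Category.id_comp _).trans (congrArg (fun k => k.hom) (Category.id_comp (η[A.X]).f))

theorem mul_ambient (A : Mon (Center D.FullSubcategory)) :
    μ[(ambient D (underlying A)).X] = (μ[A.X]).f.hom :=
  (Category.id_comp _).trans (congrArg (fun k => k.hom) (Category.id_comp (μ[A.X]).f))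

variable {D}

theorem one_ambient_comp {A : Mon (Center D.FullSubcategory)}
    {π : ∀ Y : D.FullSubcategory, A.X.1 ⟶ ihomObj Y Y} (hA : IsDeterminedBy A π)
    (Y : D.FullSubcategory) :
    η[(ambient D (underlying A)).X] ≫ (π Y).hom = ihomCoev Y.obj := by
  rw [one_ambient]
  exact congrArg (fun k => k.hom) (hA.one Y)

theorem mul_ambient_comp {A : Mon (Center D.FullSubcategory)}
    {π : ∀ Y : D.FullSubcategory, A.X.1 ⟶ ihomObj Y Y} (hA : IsDeterminedBy A π)
    (Y : D.FullSubcategory) :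
    μ[(ambient D (underlying A)).X] ≫ (π Y).hom =
      ((π Y).hom ⊗ₘ (π Y).hom) ≫ ihomComp Y.obj := by
  rw [mul_ambient]
  exact congrArg (fun k => k.hom) (hA.mul Y)

/-- A morphism to the adjoint algebra of a tensor subcategory which is compatible with the
universal families is a morphism of algebras. -/
theorem isMonHom_of_comp {A : Mon (Center C)} {π : ∀ M : C, A.X.1 ⟶ ihomObj M M}
    (hA : IsDeterminedBy A π) {B : Mon (Center D.FullSubcategory)}
    {ϖ : ∀ Y : D.FullSubcategory, B.X.1 ⟶ ihomObj Y Y} (hB : IsDeterminedBy B ϖ)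
    (hext : ∀ (E : C) (f g : E ⟶ B.X.1.obj), (∀ Y, f ≫ (ϖ Y).hom = g ≫ (ϖ Y).hom) → f = g)
    (q : (underlying A).X ⟶ (ambient D (underlying B)).X)
    (hq : ∀ Y : D.FullSubcategory, q ≫ (ϖ Y).hom = π Y.obj) : IsMonHom q where
  one_hom := hext _ _ _ fun Y => by
    refine Eq.trans ?_ (one_ambient_comp hB Y).symm
    rw [one_underlying]
    refine (Category.assoc _ _ _).trans ((congrArg (_ ≫ ·) (hq Y)).trans ?_)
    exact hA.one Y.obj
  mul_hom := hext _ _ _ fun Y => by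
    rw [mul_underlying]
    refine (Category.assoc _ _ _).trans ((congrArg (_ ≫ ·) (hq Y)).trans ?_)
    refine (hA.mul Y.obj).trans ?_
    refine Eq.trans ?_ (Category.assoc _ _ _).symm
    refine Eq.trans ?_ (congrArg (_ ≫ ·) (mul_ambient_comp hB Y)).symm
    refine Eq.trans ?_ (tensorHom_comp_tensorHom_assoc _ _ _ _ _).symm
    exact congrArg (fun t => (t ⊗ₘ t) ≫ ihomComp Y.obj) (hq Y).symm

end Ambient

theorem IsEnd.nonempty_adjointAlgebra {C : Type u} [Category.{v} C] [MonoidalCategory C]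
    [RigidCategory C] {A : C} {π : ∀ M : C, A ⟶ ihomObj M M}
    (h : IsEnd (ihomFunctor C) A π) : Nonempty (AdjointAlgebra C) :=
  ⟨{ alg := h.isUniversalAction.alg
     π := π
     isEnd := h
     isDeterminedBy := h.isUniversalAction.isDeterminedBy }⟩

end AdjointAlgebras

/-! ### The main theorem -/

theorem mainTheorem7 {k : Type w} [Field k] [IsAlgClosed k] [CharZero k]
    {C : Type u} [Category.{v} C] [Abelian C] [Linear k C] [MonoidalCategory C]
    [MonoidalPreadditive C] [MonoidalLinear k C] [RigidCategory C] [IsFiniteTensorCategory k C]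
    (D : ObjectProperty C) [IsTensorSubcategory D] :
    Nonempty (AdjointAlgebras.RelativeAdjointAlgebra D) ∧
    Nonempty (AdjointAlgebras.AdjointAlgebra C) ∧
    Nonempty (AdjointAlgebras.AdjointAlgebra D.FullSubcategory) ∧
    ∀ (AD' : AdjointAlgebras.RelativeAdjointAlgebra D) (AC : AdjointAlgebras.AdjointAlgebra C)
      (AD : AdjointAlgebras.AdjointAlgebra D.FullSubcategory),
      ∃ (i : AD'.alg ⟶ AC.alg)
        (q : AdjointAlgebras.underlying AC.alg ⟶
          AdjointAlgebras.ambient D (AdjointAlgebras.underlying AD.alg)),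
        (∀ X : C, i.hom.f ≫ AC.π X = AD'.α X) ∧
        (∀ Y : D.FullSubcategory, q.hom ≫ (AD.π Y).hom = AC.π Y.obj) ∧
        i.hom.f ≫ q.hom =
          (AD'.α (𝟙_ C) ≫ (ρ_ _).inv ≫ AdjointAlgebras.ihomEv (𝟙_ C) (𝟙_ C)) ≫
            η[(AdjointAlgebras.ambient D (AdjointAlgebras.underlying AD.alg)).X] := by
  have : ∀ X : C, IsNoetherianObject X := IsFiniteTensorCategory.isNoetherianObject k
  have : ∀ X : C, IsArtinianObject X := IsFiniteTensorCategory.isArtinianObject k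
  have : EnoughProjectives C := IsFiniteTensorCategory.enoughProjectives k
  obtain ⟨n, S, hS⟩ := IsFiniteTensorCategory.finite_simple k (C := C)
  obtain ⟨P, hP⟩ := AdjointAlgebras.exists_separatesFrom S hS
  obtain ⟨Q, hDQ, hQ⟩ := AdjointAlgebras.exists_separatesFrom_of_prop D P fun Y _ => hP Y
  obtain ⟨A₁, π₁, h₁⟩ := AdjointAlgebras.exists_isRelativeEnd hP D
  obtain ⟨A₂, π₂, h₂⟩ := AdjointAlgebras.exists_isEnd hP
  obtain ⟨A₃, π₃, h₃, -⟩ := AdjointAlgebras.exists_isEnd_fullSubcategory D hDQ hQ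
  refine ⟨⟨(AdjointAlgebras.isUniversalAction_of_isRelativeEnd D h₁).alg, π₁, h₁,
    (AdjointAlgebras.isUniversalAction_of_isRelativeEnd D h₁).isDeterminedBy⟩,
    h₂.nonempty_adjointAlgebra, h₃.nonempty_adjointAlgebra, fun AD' AC AD => ?_⟩
  have hact := (AdjointAlgebras.isAction_iff D AD'.α).2
    ⟨AD'.isRelativeEnd.dinatural, AD'.isRelativeEnd.compatible⟩
  obtain ⟨i, hi⟩ := AdjointAlgebras.IsUniversalAction.exists_algHom AD'.isDeterminedBy
    AC.isDeterminedBy AC.isEnd.isUniversalAction ((AdjointAlgebras.isAction_bot_iff _).2 AD'.isRelativeEnd.dinatural)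
  obtain ⟨hext, huniv⟩ := AD.isEnd.ambient D hDQ hQ
  obtain ⟨q, hq⟩ := huniv AC.alg.X.1 (fun Y => AC.π Y.obj) fun Y Z f => AC.isEnd.dinatural f.hom
  have hqmon := AdjointAlgebras.isMonHom_of_comp AC.isDeterminedBy AD.isDeterminedBy hext q hq
  -- The last identity is tested against the wedge of A_D: at `Y` the left side becomes α_Y, and the
  -- right side becomes α_𝟙 followed by the coevaluation of `Y`.
  refine ⟨i, { hom := q, isMonHom_hom := hqmon }, hi, hq, hext _ _ _ fun Y => ?_⟩
  refine (Category.assoc _ _ _).trans ((congrArg (i.hom.f ≫ ·) (hq Y)).trans ?_)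
  refine (hi Y.obj).trans ?_
  refine Eq.trans ?_ (Category.assoc _ _ _).symm
  refine Eq.trans ?_ (congrArg (_ ≫ ·) (AdjointAlgebras.one_ambient_comp AD.isDeterminedBy Y)).symm
  exact (AdjointAlgebras.comp_ihomCoev_eq hact Y.obj Y.property).symm
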